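/- Let $(M,h)$ and $(N,\langle\cdot,\cdot\rangle)$ be smooth finite-dimensional Riemannian manifolds without boundary, let $\delta_1,\delta_2\in\mathbb{R}$, and let $\phi\colon M\to N$ be a smooth map. Let $\nabla$ denote the Levi-Civita connections of $M$ and $N$ and the induced connection on $\phi^\ast TN$, let $R^N(X,Y)Z=[\nabla_X,\nabla_Y]Z-\nabla_{[X,Y]}Z$ be the curvature tensor of $N$, let $\tau(\phi)=\operatorname{Tr}\nabla d\phi$ be the tension field of $\phi$, and let $\Delta=\sum_\alpha(\nabla_{e_\alpha}\nabla_{e_\alpha}-\nabla_{\nabla_{e_\alpha}e_\alpha})$ be the connection Laplacian on $\phi^\ast TN$, where $(e_\alpha)$ is a local orthonormal frame of $TM$. Suppose that $\phi$ is semi-biharmonic, that is, a solution of the Euler-Lagrange equation of $E_{\delta_1,\delta_2}(\phi)=\delta_1\int_M|d\phi|^2\,dV+\delta_2\int_M|\tau(\phi)|^2\,dV$: $$\delta_2\,\Delta\tau(\phi)=\delta_2\sum_\alpha R^N(d\phi(e_\alpha),\tau(\phi))\,d\phi(e_\alpha)+\delta_1\,\tau(\phi).$$ Define the energy-momentum tensor,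 for vector fields $X,Y$ on $M$, by $$\begin{aligned}T(X,Y)={}&\delta_1\Big(\langle d\phi(X),d\phi(Y)\rangle-\tfrac12|d\phi|^2h(X,Y)\Big)\\&+\delta_2\Big(\tfrac12|\tau(\phi)|^2h(X,Y)+\langle d\phi,\nabla\tau(\phi)\rangle h(X,Y)-\langle d\phi(X),\nabla_Y\tau(\phi)\rangle-\langle d\phi(Y),\nabla_X\tau(\phi)\rangle\Big),\end{aligned}$$ where $|d\phi|^2=\sum_\alpha|d\phi(e_\alpha)|^2$ and $\langle d\phi,\nabla\tau(\phi)\rangle=\sum_\alpha\langle d\phi(e_\alpha),\nabla_{e_\alpha}\tau(\phi)\rangle$. Then $T$ is differentiable and divergence-free: $$(\operatorname{div}T)(X)=\sum_\alpha(\nabla_{e_\alpha}T)(e_\alpha,X)=0\quad\text{for every vector field }X\text{ on }M.$$ -/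

import Mathlib

open Manifold ContDiff

noncomputable section

namespace SemiBiharmonic

/-- The tangent space `T_p M` of a manifold `M` modelled on the vector space `E`. -/
abbrev T (E : Type*) [NormedAddCommGroup E] [NormedSpace ℝ E]
    {M : Type*} [TopologicalSpace M] [ChartedSpace E M] (p : M) : Type _ :=
  TangentSpace 𝓘(ℝ, E) p

/-- A smooth Riemannian metric on `M`; the inner product at `p` is `g.inner p`. -/
abbrev Metric (E : Type*) [NormedAddCommGroup E] [NormedSpace ℝ E]
    (M : Type*) [TopologicalSpace M] [ChartedSpace E M] [IsManifold 𝓘(ℝ, E) ∞ M] : Type _ :=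
  Bundle.ContMDiffRiemannianMetric 𝓘(ℝ, E) ∞ E (fun x : M => TangentSpace 𝓘(ℝ, E) x)

variable {E : Type*} [NormedAddCommGroup E] [NormedSpace ℝ E]
  {M : Type*} [TopologicalSpace M] [ChartedSpace E M] [IsManifold 𝓘(ℝ, E) ∞ M]
  {E' : Type*} [NormedAddCommGroup E'] [NormedSpace ℝ E']
  {N : Type*} [TopologicalSpace N] [ChartedSpace E' N] [IsManifold 𝓘(ℝ, E') ∞ N]

instance [FiniteDimensional ℝ E] (p : M) : FiniteDimensional ℝ (T E p) :=
  inferInstanceAs (FiniteDimensional ℝ E)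

instance (p : M) : T2Space (T E p) := inferInstanceAs (T2Space E)

/-! ### Coordinates -/

/-- `toCoord p q : T_q M → E` is the differential at `q` of the preferred chart around `p`:
it gives the components of a tangent vector with respect to the coordinate frame of this chart. -/
def toCoord (p q : M) : T E q →L[ℝ] E :=
  (trivializationAt E (fun x : M => TangentSpace 𝓘(ℝ, E) x) p).continuousLinearMapAt ℝ q

/-- `ofCoord p q : E → T_q M` is the inverse of `toCoord p q`, for `q` in the chart around `p`. -/
def ofCoord (p q : M) : E →L[ℝ] T E q :=
  (trivializationAt E (fun x : M => TangentSpace 𝓘(ℝ, E) x) p).symmL ℝ q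

/-- The local vector field extending `v ∈ T_p M` with constant components in the chart around `p`
(a linear combination, with constant coefficients, of the coordinate fields). -/
def constField {p : M} (v : T E p) : Π q : M, T E q := FiberBundle.extend E v

theorem mdiffAt_toCoord {Y : Π q : M, TangentSpace 𝓘(ℝ, E) q} {p : M}
    (hY : MDiffAt (T% Y) p) : MDiffAt (fun q => toCoord p q (Y q)) p := by
  rw [mdifferentiableAt_section] at hY
  refine hY.congr_of_eventuallyEq ?_
  filter_upwards [(trivializationAt E (fun x : M => TangentSpace 𝓘(ℝ, E) x) p).open_baseSet.mem_nhds
    (FiberBundle.mem_baseSet_trivializationAt' p)] with q hq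
  exact Bundle.Trivialization.continuousLinearMapAt_apply_of_mem ℝ _ hq _

theorem ofCoord_toCoord (p : M) (v : T E p) : ofCoord p p (toCoord p p v) = v :=
  Bundle.Trivialization.symmL_continuousLinearMapAt _
    (FiberBundle.mem_baseSet_trivializationAt' p) v

/-- The coefficients `x ↦ g_{ij}(x)` of the metric in the chart around `p`. -/
def metricInChart (g : Metric E M) (p : M) (x : E) : E →L[ℝ] E →L[ℝ] ℝ :=
  let q : M := (extChartAt 𝓘(ℝ, E) p).symm x
  ((ofCoord p q).precomp ℝ) ∘L g.inner q ∘L ofCoord p q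

variable [FiniteDimensional ℝ E] [FiniteDimensional ℝ E']

/-- The isomorphism `♯ : T_p^* M → T_p M` defined by `g`. -/
def sharp (g : Metric E M) (p : M) : (T E p →L[ℝ] ℝ) →L[ℝ] T E p := (g.inner p).inverse

/-- The trace `g^{ij} B(b_i, b_j)` with respect to `g` of a bilinear map `B` on `T_p M`, with values
in any vector space. -/
def traceAt (g : Metric E M) (p : M) {V : Type*} [AddCommGroup V] (B : T E p → T E p → V) : V :=
  let b := Module.finBasis ℝ (T E p)
  ∑ i, B (b i) (sharp g p (LinearMap.toContinuousLinearMap (b.coord i)))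

theorem inner_sharp (g : Metric E M) (p : M) (α : T E p →L[ℝ] ℝ) :
    g.inner p (sharp g p α) = α := by
  have hinj : Function.Injective (g.inner p : T E p →ₗ[ℝ] (T E p →L[ℝ] ℝ)) := by
    rw [injective_iff_map_eq_zero]
    intro v hv
    by_contra h0
    have h1 := g.pos p v h0
    have h2 : g.inner p v = 0 := hv
    simp [h2] at h1
  let D : (T E p →ₗ[ℝ] ℝ) ≃ₗ[ℝ] (T E p →L[ℝ] ℝ) := LinearMap.toContinuousLinearMap
  have hfin : FiniteDimensional ℝ (T E p →L[ℝ] ℝ) := D.finiteDimensional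
  have hdim : Module.finrank ℝ (T E p) = Module.finrank ℝ (T E p →L[ℝ] ℝ) := by
    rw [← D.finrank_eq]
    exact Subspace.dual_finrank_eq.symm
  let L : T E p ≃L[ℝ] (T E p →L[ℝ] ℝ) :=
    (LinearEquiv.ofInjectiveOfFinrankEq _ hinj hdim).toContinuousLinearEquiv
  have hL : g.inner p = (L : T E p →L[ℝ] (T E p →L[ℝ] ℝ)) := by ext v w; rfl
  have hs : sharp g p α = L.symm α := by
    rw [sharp, hL, ContinuousLinearMap.inverse_equiv]
    rfl
  rw [hs, hL]
  exact L.apply_symm_apply α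

/-- For a `g`-orthonormal basis `e`, the trace of `B` is `∑_α B(e_α, e_α)`. -/
theorem traceAt_eq_sum_orthonormal (g : Metric E M) (p : M) {V : Type*} [AddCommGroup V]
    [Module ℝ V] (B : T E p →ₗ[ℝ] T E p →ₗ[ℝ] V) {ι : Type*} [Fintype ι] [DecidableEq ι]
    (e : Module.Basis ι ℝ (T E p)) (he : ∀ i j, g.inner p (e i) (e j) = if i = j then 1 else 0) :
    traceAt g p (fun u v => B u v) = ∑ i, B (e i) (e i) := by
  have hexp : ∀ v : T E p, v = ∑ a, g.inner p v (e a) • e a := by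
    intro v
    have hc : ∀ a, g.inner p v (e a) = e.repr v a := by
      intro a
      conv_lhs => rw [← e.sum_repr v]
      simp only [map_sum, map_smul, sum_apply, smul_apply, he]
      simp
    simp only [hc]
    exact (e.sum_repr v).symm
  unfold traceAt
  dsimp only
  have h1 : ∀ i, B (Module.finBasis ℝ (T E p) i) (sharp g p (LinearMap.toContinuousLinearMap
      ((Module.finBasis ℝ (T E p)).coord i))) =
      ∑ a, (Module.finBasis ℝ (T E p)).repr (e a) i •
        B (Module.finBasis ℝ (T E p) i) (e a) := by
    intro i
    conv_lhs => rw [hexp (sharp g p _)]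
    simp [inner_sharp]
  simp_rw [h1]
  rw [Finset.sum_comm]
  refine Finset.sum_congr rfl fun a _ => ?_
  have h2 := congrArg (fun x => B x (e a)) ((Module.finBasis ℝ (T E p)).sum_repr (e a))
  simpa only [map_sum, map_smul, LinearMap.sum_apply, LinearMap.smul_apply] using h2

/-! ### Levi-Civita connection -/

/-- The Christoffel symbols of the first kind in the chart around `p`:
`Γ_{ij,k} = (∂_i g_{jk} + ∂_j g_{ik} - ∂_k g_{ij}) / 2`. -/
def christoffelLower (g : Metric E M) (p : M) (x u v w : E) : ℝ :=
  let D := fderiv ℝ (metricInChart g p) x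
  (D u v w + D v u w - D w u v) / 2

/-- The Christoffel symbols of the second kind in the chart around `p`:
`Γ(u, v) = Γ_{ij}^k u^i v^j ∂_k` with `Γ_{ij}^k = g^{kl} Γ_{ij,l}`. -/
def christoffel (g : Metric E M) (p : M) (x : E) : E →ₗ[ℝ] E →ₗ[ℝ] E :=
  let b := Module.finBasis ℝ E
  let c := fun l => (metricInChart g p x).inverse (LinearMap.toContinuousLinearMap (b.coord l))
  LinearMap.mk₂ ℝ (fun u v => ∑ l, christoffelLower g p x u v (b l) • c l)
    (by
      intro u u' v
      rw [← Finset.sum_add_distrib]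
      refine Finset.sum_congr rfl fun l _ => ?_
      simp only [christoffelLower, map_add, add_apply]
      module)
    (by
      intro a u v
      rw [Finset.smul_sum]
      refine Finset.sum_congr rfl fun l _ => ?_
      simp only [christoffelLower, map_smul, smul_apply, smul_eq_mul]
      module)
    (by
      intro u v v'
      rw [← Finset.sum_add_distrib]
      refine Finset.sum_congr rfl fun l _ => ?_
      simp only [christoffelLower, map_add, add_apply]
      module)
    (by
      intro a u v
      rw [Finset.smul_sum]
      refine Finset.sum_congr rfl fun l _ => ?_
      simp only [christoffelLower, map_smul, smul_apply, smul_eq_mul]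
      module)

/-- The Levi-Civita connection of `g`: in the chart around `p`, the components of `∇_u Y` at `p`
are `u^i ∂_i Y^k + Γ_{ij}^k u^i Y^j`. The value `∇_u Y` is written `leviCivita g Y p u`. -/
def leviCivita (g : Metric E M) :
    CovariantDerivative 𝓘(ℝ, E) E (fun x : M => TangentSpace 𝓘(ℝ, E) x) where
  toFun Y (p : M) := ofCoord p p ∘L
    (mvfderiv 𝓘(ℝ, E) (fun q => toCoord p q (Y q)) p +
      LinearMap.toContinuousLinearMap
        ((christoffel g p (extChartAt 𝓘(ℝ, E) p p)).flip (toCoord p p (Y p))) ∘L toCoord p p)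
  isCovariantDerivativeOnUniv :=
    { add := by
        intro Y Y' p hY hY' _
        have h := mvfderiv_fun_add (mdiffAt_toCoord hY) (mdiffAt_toCoord hY')
        ext u
        simp only [Pi.add_apply, map_add, h, ContinuousLinearMap.comp_apply, add_apply,
          LinearMap.coe_toContinuousLinearMap']
        abel
      leibniz := by
        intro Y f p hY hf _
        have h := mvfderiv_fun_smul hf (mdiffAt_toCoord hY)
        ext u
        simp only [Pi.smul_apply', map_smul, h, ContinuousLinearMap.comp_apply, add_apply,
          LinearMap.coe_toContinuousLinearMap', smul_apply, map_add,
          ContinuousLinearMap.smulRight_apply, ofCoord_toCoord, smul_add]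
        abel }

/-! ### Calculus along a map -/

/-- The differential `dφ_p : T_p M → T_{φ(p)} N`. -/
abbrev diff (E E' : Type*) [NormedAddCommGroup E] [NormedSpace ℝ E] [NormedAddCommGroup E']
    [NormedSpace ℝ E'] {M : Type*} [TopologicalSpace M] [ChartedSpace E M]
    {N : Type*} [TopologicalSpace N] [ChartedSpace E' N] (φ : M → N) (p : M) :
    T E p →L[ℝ] T E' (φ p) :=
  mfderiv 𝓘(ℝ, E) 𝓘(ℝ, E') φ p

/-- The connection on `φ^* TN` induced by the Levi-Civita connection of `N`, applied to a section
`V` of `φ^* TN`: if `V = V^k (∂_k ∘ φ)` then `∇_u V = (u V^k) ∂_k + V^k ∇^N_{dφ(u)} ∂_k`.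
The value `∇_u V` at `p` is written `covAlong E h φ V p u`. -/
def covAlong (E : Type*) [NormedAddCommGroup E] [NormedSpace ℝ E]
    {M : Type*} [TopologicalSpace M] [ChartedSpace E M]
    (h : Metric E' N) (φ : M → N) (V : Π p : M, T E' (φ p)) (p : M) : T E p →L[ℝ] T E' (φ p) :=
  ofCoord (φ p) (φ p) ∘L mvfderiv 𝓘(ℝ, E) (fun q => toCoord (φ p) (φ q) (V q)) p +
    leviCivita h (constField (V p)) (φ p) ∘L diff E E' φ p

/-- The second fundamental form `(∇dφ)(u, w) = ∇_u (dφ(W)) - dφ(∇_u W)`, where `W` extends `w`. -/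
def hessian (g : Metric E M) (h : Metric E' N) (φ : M → N) (p : M) (u w : T E p) : T E' (φ p) :=
  covAlong E h φ (fun q => diff E E' φ q (constField w q)) p u -
    diff E E' φ p (leviCivita g (constField w) p u)

/-- The tension field `τ(φ) = Tr ∇dφ`. -/
def tension (g : Metric E M) (h : Metric E' N) (φ : M → N) (p : M) : T E' (φ p) :=
  traceAt g p (hessian g h φ p)

/-- The connection Laplacian `Δ V = Tr (∇∇V)` on `φ^* TN`, the trace of
`(u, w) ↦ ∇_u ∇_W V - ∇_{∇_u W} V`, where `W` extends `w`. -/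
def laplacian (g : Metric E M) (h : Metric E' N) (φ : M → N) (V : Π p : M, T E' (φ p)) (p : M) :
    T E' (φ p) :=
  traceAt g p fun u w =>
    covAlong E h φ (fun q => covAlong E h φ V q (constField w q)) p u -
      covAlong E h φ V p (leviCivita g (constField w) p u)

/-- The curvature tensor `R(u, v) w = ∇_u ∇_v w - ∇_v ∇_u w - ∇_{[u, v]} w` of `N` at `y`, where
`u`, `v`, `w` are extended to local vector fields. -/
def curvature (h : Metric E' N) (y : N) (u v w : T E' y) : T E' y :=
  leviCivita h (fun z => leviCivita h (constField w) z (constField v z)) y u -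
    leviCivita h (fun z => leviCivita h (constField w) z (constField u z)) y v -
    leviCivita h (constField w) y
      (VectorField.mlieBracket 𝓘(ℝ, E') (constField u) (constField v) y)

/-- `φ` is semi-biharmonic: it solves the Euler-Lagrange equation
`δ₂ Δτ(φ) = δ₂ ∑_α R^N(dφ(e_α), τ(φ)) dφ(e_α) + δ₁ τ(φ)` of
`δ₁ ∫ |dφ|² + δ₂ ∫ |τ(φ)|²`. -/
def IsSemiBiharmonic (g : Metric E M) (h : Metric E' N) (δ₁ δ₂ : ℝ) (φ : M → N) : Prop :=
  ∀ p : M, δ₂ • laplacian g h φ (tension g h φ) p =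
    δ₂ • traceAt g p (fun u w =>
        curvature h (φ p) (diff E E' φ p u) (tension g h φ p) (diff E E' φ p w)) +
      δ₁ • tension g h φ p

/-! ### Energy-momentum tensor -/

/-- `|dφ|² = ∑_α ⟨dφ(e_α), dφ(e_α)⟩`. -/
def normSqD (g : Metric E M) (h : Metric E' N) (φ : M → N) (p : M) : ℝ :=
  traceAt g p fun u w => h.inner (φ p) (diff E E' φ p u) (diff E E' φ p w)

/-- `⟨dφ, ∇V⟩ = ∑_α ⟨dφ(e_α), ∇_{e_α} V⟩`. -/
def innerDCov (g : Metric E M) (h : Metric E' N) (φ : M → N) (V : Π p : M, T E' (φ p)) (p : M) :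
    ℝ :=
  traceAt g p fun u w => h.inner (φ p) (diff E E' φ p u) (covAlong E h φ V p w)

/-- The energy-momentum tensor, as a bilinear form on each tangent space `T_p M`. -/
def energyMomentum (g : Metric E M) (h : Metric E' N) (δ₁ δ₂ : ℝ) (φ : M → N) (p : M) :
    T E p →ₗ[ℝ] T E p →ₗ[ℝ] ℝ :=
  let τ := tension g h φ
  LinearMap.mk₂ ℝ
    (fun X Y =>
      δ₁ * (h.inner (φ p) (diff E E' φ p X) (diff E E' φ p Y)
        - 1 / 2 * normSqD g h φ p * g.inner p X Y)
      + δ₂ * (1 / 2 * h.inner (φ p) (τ p) (τ p) * g.inner p X Y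
        + innerDCov g h φ τ p * g.inner p X Y
        - h.inner (φ p) (diff E E' φ p X) (covAlong E h φ τ p Y)
        - h.inner (φ p) (diff E E' φ p Y) (covAlong E h φ τ p X)))
    (by intros; simp only [map_add, add_apply]; ring)
    (by intros; simp only [map_smul, smul_apply, smul_eq_mul]; ring)
    (by intros; simp only [map_add, add_apply]; ring)
    (by intros; simp only [map_smul, smul_apply, smul_eq_mul]; ring)

/-- The covariant derivative of a `(0,2)`-tensor:
`(∇_u S)(v, w) = u (S(V, W)) - S(∇_u V, w) - S(v, ∇_u W)`, where `V`, `W` extend `v`, `w`. -/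
def covTensor (g : Metric E M) (S : Π p : M, T E p →ₗ[ℝ] T E p →ₗ[ℝ] ℝ) (p : M)
    (u v w : T E p) : ℝ :=
  mvfderiv 𝓘(ℝ, E) (fun q => S q (constField v q) (constField w q)) p u -
    S p (leviCivita g (constField v) p u) w - S p v (leviCivita g (constField w) p u)

/-- The divergence `(div S)(w) = ∑_α (∇_{e_α} S)(e_α, w)` of a `(0,2)`-tensor. -/
def divergence (g : Metric E M) (S : Π p : M, T E p →ₗ[ℝ] T E p →ₗ[ℝ] ℝ) (p : M)
    (w : T E p) : ℝ :=
  traceAt g p fun u v => covTensor g S p u v w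

/-- `S` is differentiable (its components in charts are), and its divergence vanishes. -/
def IsDivergenceFree (g : Metric E M) (S : Π p : M, T E p →ₗ[ℝ] T E p →ₗ[ℝ] ℝ) : Prop :=
  (∀ (p : M) (v w : T E p), MDifferentiableAt 𝓘(ℝ, E) 𝓘(ℝ, ℝ)
    (fun q => S q (constField v q) (constField w q)) p) ∧
  ∀ (p : M) (w : T E p), divergence g S p w = 0

end SemiBiharmonic
end

noncomputable section

namespace SemiBiharmonic

set_option maxSynthPendingDepth 3
set_option linter.unusedSectionVars false

/-! ### Calculus in coordinates: connection coefficients, vector fields along a map, curvature. -/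

section Flat

variable {E F V : Type*} [NormedAddCommGroup E] [NormedSpace ℝ E] 
  [NormedAddCommGroup F] [NormedSpace ℝ F] 
  [NormedAddCommGroup V] [NormedSpace ℝ V]

/-! The proof is a pointwise Leibniz computation. The metric of `M` is parallel and `∇dφ` is
symmetric with trace `τ`. In the `δ₁` part the trace of `⟨dφ(e), ∇dφ(e, X)⟩` cancels half the
derivative of `|dφ|²`, which leaves `δ₁⟨τ, dφ(X)⟩`. In the `δ₂` part the derivative of `|τ|²/2`
cancels the term `⟨τ, ∇_X τ⟩` coming from the trace of `∇dφ`, and the products of `∇dφ` with `∇τ`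
cancel by symmetry of `∇dφ`. What remains is `∑⟨dφ(e), ∇²τ(X, e) - ∇²τ(e, X)⟩ - ⟨dφ(X), Δτ⟩`. The
Ricci identity `covDeriv₂_sub_swap` turns the difference into `R(dφ(X), dφ(e))τ`, and the curvature
symmetries `curv_pair_symm` and `curv_skew` turn its pairing with `dφ(e)` into `⟨dφ(X), R(dφ(e),
τ)dφ(e)⟩`. Pairing the Euler-Lagrange equation with `dφ(X)` gives zero. This is `divergence_stress`,
carried out on normed spaces for any coefficient functions satisfying `IsLeviCivitaAt`.

The transfer to manifolds has one real difficulty: every operator is defined at a point through the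
preferred chart of that same point, so an iterated operator involves charts that vary with the
point. `covAlong_ofCoord` shows that one fixed pair of charts computes the covariant derivative at
all points they cover. It rests on the transformation law `connection_transition`, which holds
because a transition map is an isometry between coordinate metrics and a torsion-free metric
connection is determined by its metric (`fderiv_connection_of_isometry`). Traces are moved to
coordinates by `traceAt_eq_trace`, since contraction does not depend on the basis. -/

/-- The connection coefficients `Γ` are compatible with the metric coefficients `G` at `x`. -/
def MetricCompatAt (G : E → E →L[ℝ] E →L[ℝ] ℝ) (Γ : E → E →L[ℝ] E →L[ℝ] E) (x : E) : Prop :=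
  ∀ u v w, fderiv ℝ G x u v w = G x (Γ x u v) w + G x v (Γ x u w)

/-- The covariant derivative, with connection coefficients `Γ`, of a vector field `s` along `f`. -/
def covDeriv (Γ : F → F →L[ℝ] F →L[ℝ] F) (f s : E → F) (x : E) : E →L[ℝ] F :=
  fderiv ℝ s x + (Γ (f x)).flip (s x) ∘L fderiv ℝ f x

theorem covDeriv_apply (Γ : F → F →L[ℝ] F →L[ℝ] F) (f s : E → F) (x u : E) :
    covDeriv Γ f s x u = fderiv ℝ s x u + Γ (f x) (fderiv ℝ f x u) (s x) := rfl

/-- The second fundamental form of `f` in coordinates. -/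
def secondFF (Γ : E → E →L[ℝ] E →L[ℝ] E) (Γ' : F → F →L[ℝ] F →L[ℝ] F) (f : E → F) (x : E) :
    E →L[ℝ] E →L[ℝ] F :=
  fderiv ℝ (fderiv ℝ f) x + (Γ' (f x)).bilinearComp (fderiv ℝ f x) (fderiv ℝ f x) -
    (ContinuousLinearMap.compL ℝ E E F (fderiv ℝ f x)) ∘L Γ x

theorem secondFF_apply (Γ : E → E →L[ℝ] E →L[ℝ] E) (Γ' : F → F →L[ℝ] F →L[ℝ] F) (f : E → F)
    (x u v : E) : secondFF Γ Γ' f x u v = fderiv ℝ (fderiv ℝ f) x u v +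
      Γ' (f x) (fderiv ℝ f x u) (fderiv ℝ f x v) - fderiv ℝ f x (Γ x u v) := rfl

/-- The curvature tensor of the connection with coefficients `Γ`. -/
def curv (Γ : F → F →L[ℝ] F →L[ℝ] F) (y u v w : F) : F :=
  fderiv ℝ Γ y u v w + Γ y u (Γ y v w) - (fderiv ℝ Γ y v u w + Γ y v (Γ y u w))

/-- A basis of `E` identifies `E →L[ℝ] F` with a finite power of `F`, so smoothness may be tested on
fixed vectors. This reduces smoothness of tensor-valued maps to that of their components. -/
theorem contDiffAt_clm_of_apply {D : Type*} [NormedAddCommGroup D] [NormedSpace ℝ D]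
    [FiniteDimensional ℝ E] {f : D → E →L[ℝ] F} {x : D}
    (h : ∀ u, ContDiffAt ℝ ∞ (fun z => f z u) x) : ContDiffAt ℝ ∞ f x := by
  let d := Module.finrank ℝ E
  have hd : d = Module.finrank ℝ (Fin d → ℝ) := (Module.finrank_fin_fun ℝ).symm
  let e₁ := ContinuousLinearEquiv.ofFinrankEq hd
  let e₂ := (e₁.arrowCongr (1 : F ≃L[ℝ] F)).trans (ContinuousLinearEquiv.piRing (Fin d))
  rw [← Function.id_comp f, ← e₂.symm_comp_self]
  exact e₂.symm.contDiff.contDiffAt.comp x (contDiffAt_pi.mpr fun i => h _)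

theorem contDiffAt_fderiv {f : E → F} {x : E} (hf : ContDiffAt ℝ ∞ f x) :
    ContDiffAt ℝ ∞ (fderiv ℝ f) x := hf.fderiv_right (by norm_cast)

theorem differentiableAt_of_smooth {f : E → F} {x : E} (hf : ContDiffAt ℝ ∞ f x) :
    DifferentiableAt ℝ f x := hf.differentiableAt (by simp)

theorem isSymmSndFDerivAt_of_smooth {f : E → F} {x : E} (hf : ContDiffAt ℝ ∞ f x) :
    IsSymmSndFDerivAt ℝ f x := hf.isSymmSndFDerivAt (by simp; norm_cast)

/-- The product rule for a bilinear map composed with vector fields along `f`. -/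
theorem fderiv_bilin_comp {H : F → F →L[ℝ] F →L[ℝ] V} {f s t : E → F} {x : E}
    (hH : DifferentiableAt ℝ H (f x)) (hf : DifferentiableAt ℝ f x) (hs : DifferentiableAt ℝ s x)
    (ht : DifferentiableAt ℝ t x) (u : E) :
    fderiv ℝ (fun z => H (f z) (s z) (t z)) x u =
      fderiv ℝ H (f x) (fderiv ℝ f x u) (s x) (t x) + H (f x) (fderiv ℝ s x u) (t x) +
        H (f x) (s x) (fderiv ℝ t x u) := by
  have h0 : HasFDerivAt (fun z => H (f z)) (fderiv ℝ H (f x) ∘L fderiv ℝ f x) x :=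
    hH.hasFDerivAt.comp x hf.hasFDerivAt
  have h1 : HasFDerivAt (fun z => H (f z) (s z)) _ x := h0.clm_apply hs.hasFDerivAt
  rw [(h1.clm_apply ht.hasFDerivAt).fderiv]
  simp
  abel

/-- The derivative of the coefficients `H` along `f` is exactly what upgrades the plain derivatives
of `s` and `t` to covariant ones. Compatibility is needed only at the point `f x`. -/
theorem fderiv_inner_along {H : F → F →L[ℝ] F →L[ℝ] ℝ} {Γ : F → F →L[ℝ] F →L[ℝ] F}
    {f s t : E → F} {x : E} (hH : DifferentiableAt ℝ H (f x)) (hf : DifferentiableAt ℝ f x)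
    (hs : DifferentiableAt ℝ s x) (ht : DifferentiableAt ℝ t x) (hc : MetricCompatAt H Γ (f x))
    (u : E) :
    fderiv ℝ (fun z => H (f z) (s z) (t z)) x u =
      H (f x) (covDeriv Γ f s x u) (t x) + H (f x) (s x) (covDeriv Γ f t x u) := by
  rw [fderiv_bilin_comp hH hf hs ht, hc]
  simp only [covDeriv_apply, map_add, add_apply]
  ring

theorem secondFF_symm {Γ : E → E →L[ℝ] E →L[ℝ] E} {Γ' : F → F →L[ℝ] F →L[ℝ] F} {f : E → F}
    {x : E} (hf : ContDiffAt ℝ ∞ f x) (hΓ : ∀ u v, Γ x u v = Γ x v u)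
    (hΓ' : ∀ u v, Γ' (f x) u v = Γ' (f x) v u) (u v : E) :
    secondFF Γ Γ' f x u v = secondFF Γ Γ' f x v u := by
  simp only [secondFF_apply]
  rw [(isSymmSndFDerivAt_of_smooth hf) u v, hΓ, hΓ']

/-- Covariant derivative of the image of a constant field. -/
theorem covDeriv_fderiv_apply {Γ : E → E →L[ℝ] E →L[ℝ] E} {Γ' : F → F →L[ℝ] F →L[ℝ] F} {f : E → F}
    {x : E} (hf : ContDiffAt ℝ ∞ f x) (u v : E) :
    covDeriv Γ' f (fun z => fderiv ℝ f z v) x u =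
      secondFF Γ Γ' f x u v + fderiv ℝ f x (Γ x u v) := by
  rw [covDeriv_apply, secondFF_apply,
    ((differentiableAt_of_smooth (contDiffAt_fderiv hf)).hasFDerivAt.clm_apply
      (hasFDerivAt_const v x)).fderiv]
  simp

theorem contDiffAt_covDeriv [FiniteDimensional ℝ E] {Γ : F → F →L[ℝ] F →L[ℝ] F} {f s : E → F}
    {x : E} (hΓ : ContDiffAt ℝ ∞ Γ (f x)) (hf : ContDiffAt ℝ ∞ f x) (hs : ContDiffAt ℝ ∞ s x) :
    ContDiffAt ℝ ∞ (covDeriv Γ f s) x := by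
  refine contDiffAt_clm_of_apply fun u => ?_
  exact ((contDiffAt_fderiv hs).clm_apply contDiffAt_const).add
    (((hΓ.comp x hf).clm_apply ((contDiffAt_fderiv hf).clm_apply contDiffAt_const)).clm_apply hs)

theorem contDiffAt_secondFF [FiniteDimensional ℝ E] {Γ : E → E →L[ℝ] E →L[ℝ] E}
    {Γ' : F → F →L[ℝ] F →L[ℝ] F} {f : E → F} {x : E} (hΓ : ContDiffAt ℝ ∞ Γ x)
    (hΓ' : ContDiffAt ℝ ∞ Γ' (f x)) (hf : ContDiffAt ℝ ∞ f x) :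
    ContDiffAt ℝ ∞ (secondFF Γ Γ' f) x := by
  refine contDiffAt_clm_of_apply fun u => contDiffAt_clm_of_apply fun v => ?_
  have hd := contDiffAt_fderiv hf
  exact ((((contDiffAt_fderiv hd).clm_apply contDiffAt_const).clm_apply contDiffAt_const).add
    (((hΓ'.comp x hf).clm_apply (hd.clm_apply contDiffAt_const)).clm_apply
      (hd.clm_apply contDiffAt_const))).sub
    (hd.clm_apply ((hΓ.clm_apply contDiffAt_const).clm_apply contDiffAt_const))

/-- The second covariant derivative `∇²s(u, v)` of a vector field along `f`. -/
def covDeriv₂ (Γ : E → E →L[ℝ] E →L[ℝ] E) (Γ' : F → F →L[ℝ] F →L[ℝ] F) (f s : E → F) (x : E) :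
    E →L[ℝ] E →L[ℝ] F :=
  fderiv ℝ (covDeriv Γ' f s) x +
    ((Γ' (f x)).bilinearComp (fderiv ℝ f x) (covDeriv Γ' f s x)) -
    (ContinuousLinearMap.compL ℝ E E F (covDeriv Γ' f s x)) ∘L Γ x

theorem covDeriv₂_apply {Γ : E → E →L[ℝ] E →L[ℝ] E} {Γ' : F → F →L[ℝ] F →L[ℝ] F} {f s : E → F}
    {x : E} (h : DifferentiableAt ℝ (covDeriv Γ' f s) x) (u v : E) :
    covDeriv₂ Γ Γ' f s x u v = covDeriv Γ' f (fun z => covDeriv Γ' f s z v) x u -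
      covDeriv Γ' f s x (Γ x u v) := by
  rw [covDeriv_apply (s := fun z => covDeriv Γ' f s z v),
    (h.hasFDerivAt.clm_apply (hasFDerivAt_const v x)).fderiv]
  simp [covDeriv₂]

/-- The Ricci identity for vector fields along `f`. -/
theorem covDeriv₂_sub_swap [FiniteDimensional ℝ E] {Γ : E → E →L[ℝ] E →L[ℝ] E}
    {Γ' : F → F →L[ℝ] F →L[ℝ] F} {f s : E → F}
    {x : E} (hΓ : ∀ u v, Γ x u v = Γ x v u) (hΓ' : ContDiffAt ℝ ∞ Γ' (f x))
    (hf : ContDiffAt ℝ ∞ f x) (hs : ContDiffAt ℝ ∞ s x) (u v : E) :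
    covDeriv₂ Γ Γ' f s x u v - covDeriv₂ Γ Γ' f s x v u =
      curv Γ' (f x) (fderiv ℝ f x u) (fderiv ℝ f x v) (s x) := by
  have hd := differentiableAt_of_smooth (contDiffAt_fderiv hf)
  have hds := differentiableAt_of_smooth (contDiffAt_fderiv hs)
  have key : ∀ u v, fderiv ℝ (fun z => covDeriv Γ' f s z v) x u =
      fderiv ℝ (fderiv ℝ s) x u v +
      (fderiv ℝ Γ' (f x) (fderiv ℝ f x u) (fderiv ℝ f x v) (s x) +
        Γ' (f x) (fderiv ℝ (fderiv ℝ f) x u v) (s x) +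
        Γ' (f x) (fderiv ℝ f x v) (fderiv ℝ s x u)) := by
    intro u v
    have e : (fun z => covDeriv Γ' f s z v) = (fun z => fderiv ℝ s z v) +
        fun z => Γ' (f z) (fderiv ℝ f z v) (s z) := rfl
    have h1 := hd.hasFDerivAt.clm_apply (hasFDerivAt_const v x)
    have h2 := hds.hasFDerivAt.clm_apply (hasFDerivAt_const v x)
    have h3 : DifferentiableAt ℝ (fun z => Γ' (f z) (fderiv ℝ f z v) (s z)) x :=
      ((((differentiableAt_of_smooth hΓ').comp x (differentiableAt_of_smooth hf)).clm_apply
        h1.differentiableAt).clm_apply (differentiableAt_of_smooth hs))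
    rw [e, fderiv_add h2.differentiableAt h3, add_apply,
      fderiv_bilin_comp (differentiableAt_of_smooth hΓ') (differentiableAt_of_smooth hf)
        h1.differentiableAt (differentiableAt_of_smooth hs), h1.fderiv, h2.fderiv]
    simp
  have hc := differentiableAt_of_smooth (contDiffAt_covDeriv hΓ' hf hs)
  -- The second derivatives of `f` and `s` are symmetric and the products of `Γ'` with `fderiv ℝ s
  -- x` pair up, so only the derivative of `Γ'` and the terms quadratic in `Γ'` survive
  -- antisymmetrisation.
  rw [covDeriv₂_apply hc, covDeriv₂_apply hc]
  simp only [covDeriv_apply Γ' f (fun z => covDeriv Γ' f s z _), key, hΓ v u, curv]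
  rw [(isSymmSndFDerivAt_of_smooth hf) v u, (isSymmSndFDerivAt_of_smooth hs) v u]
  simp only [covDeriv_apply, map_add]
  abel

/-! ### Symmetries of the curvature tensor -/

section Curvature

variable {H : F → F →L[ℝ] F →L[ℝ] ℝ} {Γ : F → F →L[ℝ] F →L[ℝ] F} {y : F}

theorem curv_swap (u v w : F) : curv Γ y u v w = -curv Γ y v u w := by
  simp only [curv]; abel

/-- Symmetry of `Γ` on a neighbourhood passes to the last two slots of its derivative; the terms of
the cyclic sum then cancel in pairs. -/
theorem curv_bianchi (hd : DifferentiableAt ℝ Γ y) (hs : ∀ᶠ z in nhds y, ∀ u v, Γ z u v = Γ z v u)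
    (u v w : F) : curv Γ y u v w + curv Γ y v w u + curv Γ y w u v = 0 := by
  have hD : ∀ a b c, fderiv ℝ Γ y a b c = fderiv ℝ Γ y a c b := by
    intro a b c
    have e : (fun z => Γ z b c) =ᶠ[nhds y] fun z => Γ z c b := hs.mono fun z hz => hz b c
    have h1 := ((hd.hasFDerivAt.clm_apply (hasFDerivAt_const b y)).clm_apply
      (hasFDerivAt_const c y)).fderiv
    have h2 := ((hd.hasFDerivAt.clm_apply (hasFDerivAt_const c y)).clm_apply
      (hasFDerivAt_const b y)).fderiv
    have h3 := e.fderiv_eq (𝕜 := ℝ)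
    rw [h1, h2] at h3
    simpa using congrArg (fun L => L a) h3
  have hs := hs.self_of_nhds
  simp only [curv]
  rw [hD v w u, hD u w v, hD w v u, hs w u, hs v u, hs w v]
  abel

/-- Differentiating the compatibility equation expresses the second derivative of `H` through `Γ`.
That derivative is symmetric in its two directions, and so is the sum of the mixed products `H(Γ·,
Γ·)`; antisymmetrising leaves the curvature terms. Compatibility must therefore hold near `y`, not
just at `y`. -/
theorem curv_skew (hH : ContDiffAt ℝ ∞ H y) (hd : DifferentiableAt ℝ Γ y)
    (hc : ∀ᶠ z in nhds y, MetricCompatAt H Γ z) (u v w t : F) :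
    H y (curv Γ y u v w) t + H y w (curv Γ y u v t) = 0 := by
  have hHd := differentiableAt_of_smooth hH
  have hc0 := hc.self_of_nhds
  have key : ∀ a b : F, fderiv ℝ (fderiv ℝ H) y a b w t =
      H y (fderiv ℝ Γ y a b w) t + H y w (fderiv ℝ Γ y a b t)
      + (H y (Γ y a (Γ y b w)) t + H y (Γ y b w) (Γ y a t))
      + (H y (Γ y a w) (Γ y b t) + H y w (Γ y a (Γ y b t))) := by
    intro a b
    have e : (fun z => fderiv ℝ H z b w t) =ᶠ[nhds y]
        fun z => H z (Γ z b w) t + H z w (Γ z b t) := hc.mono fun z hz => hz b w t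
    have h1 := (((differentiableAt_of_smooth (contDiffAt_fderiv hH)).hasFDerivAt.clm_apply
      (hasFDerivAt_const b y)).clm_apply (hasFDerivAt_const w y)).clm_apply (hasFDerivAt_const t y)
    have hg : ∀ c, HasFDerivAt (fun z => Γ z b c) _ y := fun c =>
      (hd.hasFDerivAt.clm_apply (hasFDerivAt_const b y)).clm_apply (hasFDerivAt_const c y)
    have h2 := ((hHd.hasFDerivAt.clm_apply (hg w)).clm_apply (hasFDerivAt_const t y)).add
      ((hHd.hasFDerivAt.clm_apply (hasFDerivAt_const w y)).clm_apply (hg t))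
    have h3 := e.fderiv_eq (𝕜 := ℝ)
    have h2' := h2.fderiv
    rw [h1.fderiv] at h3
    have h4 := congrArg (fun L : F →L[ℝ] ℝ => L a) (h3.trans h2')
    simp at h4
    rw [h4, hc0, hc0]
    ring
  have hsym := isSymmSndFDerivAt_of_smooth hH u v
  have h5 := congrArg (fun L : F →L[ℝ] F →L[ℝ] ℝ => L w t) hsym
  simp only [key] at h5
  simp only [curv, map_add, map_sub, add_apply, sub_apply]
  linarith

theorem curv_pair_symm (hH : ContDiffAt ℝ ∞ H y) (hHs : ∀ u v, H y u v = H y v u)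
    (hd : DifferentiableAt ℝ Γ y) (hs : ∀ᶠ z in nhds y, ∀ u v, Γ z u v = Γ z v u)
    (hc : ∀ᶠ z in nhds y, MetricCompatAt H Γ z) (u v w t : F) :
    H y (curv Γ y u v w) t = H y (curv Γ y w t u) v := by
  have B : ∀ a b c d, H y (curv Γ y a b c) d + H y (curv Γ y b c a) d + H y (curv Γ y c a b) d = 0
  · intro a b c d
    have := congrArg (fun x => H y x d) (curv_bianchi hd hs a b c)
    simpa using this
  have S : ∀ a b c d, H y (curv Γ y a b c) d = - H y (curv Γ y a b d) c := by
    intro a b c d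
    rw [hHs (curv Γ y a b d) c]
    linarith [curv_skew hH hd hc a b c d]
  have A : ∀ a b c d, H y (curv Γ y a b c) d = - H y (curv Γ y b a c) d := by
    intro a b c d
    rw [curv_swap, map_neg, neg_apply]
  -- The first two cyclic identities minus the last two: by skewness in either pair of slots
  -- everything cancels except twice the difference of the two sides.
  linarith [B u v w t, B v w t u, B w t u v, B t u v w, S v w t u, S w t v u, S u w t v, S u v t w,
    A t v w u, S v t w u, A t u w v, S u t w v, A t u v w, A w u v t]

end Curvature

end Flat

/-! ### Metric traces, their derivatives, and uniqueness of the Levi-Civita coefficients. -/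

section FlatTrace

variable {E F V : Type*} [NormedAddCommGroup E] [NormedSpace ℝ E] [FiniteDimensional ℝ E]
  [NormedAddCommGroup F] [NormedSpace ℝ F]
  [NormedAddCommGroup V] [NormedSpace ℝ V]

/-- The vectors `g^{ij} b_j`, where `b` is the chosen basis of `E`. -/
def raised (G : E →L[ℝ] E →L[ℝ] ℝ) (i : Fin (Module.finrank ℝ E)) : E :=
  G.inverse (LinearMap.toContinuousLinearMap ((Module.finBasis ℝ E).coord i))

/-- The trace of `B` with respect to the bilinear form `G`. -/
def trace (G : E →L[ℝ] E →L[ℝ] ℝ) {V : Type*} [AddCommGroup V] (B : E → E → V) : V :=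
  ∑ i, B (Module.finBasis ℝ E i) (raised G i)

theorem apply_raised {G : E →L[ℝ] E →L[ℝ] ℝ} (hG : G.IsInvertible)
    (i : Fin (Module.finrank ℝ E)) (v : E) : G (raised G i) v = (Module.finBasis ℝ E).repr v i := by
  rw [raised, hG.self_apply_inverse]
  rfl

theorem eq_of_apply_eq {G : E →L[ℝ] E →L[ℝ] ℝ} (hG : G.IsInvertible) {a b : E}
    (h : ∀ w, G a w = G b w) : a = b := hG.injective (ContinuousLinearMap.ext h)

section Linear

variable {G : E →L[ℝ] E →L[ℝ] ℝ}

/-- The scalar `G (raised G i) (raised G j)` is the inverse matrix entry `g^{ij}`; in this form the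
symmetry of the trace in its two slots is visible. -/
theorem trace_eq_sum (hG : G.IsInvertible) (hs : ∀ u v, G u v = G v u)
    (B : E →L[ℝ] E →L[ℝ] V) : trace G (fun u v => B u v) =
      ∑ i, ∑ j, G (raised G i) (raised G j) • B (Module.finBasis ℝ E i) (Module.finBasis ℝ E j) := by
  refine Finset.sum_congr rfl fun i _ => ?_
  conv_lhs => rw [← (Module.finBasis ℝ E).sum_repr (raised G i)]
  simp only [map_sum, map_smul]
  refine Finset.sum_congr rfl fun j _ => ?_
  rw [hs, apply_raised hG]

theorem trace_swap (hG : G.IsInvertible) (hs : ∀ u v, G u v = G v u)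
    (B : E →L[ℝ] E →L[ℝ] V) : trace G (fun u v => B v u) = trace G (fun u v => B u v) := by
  have h := trace_eq_sum hG hs B.flip
  simp only [ContinuousLinearMap.flip_apply] at h
  rw [h, trace_eq_sum hG hs, Finset.sum_comm]
  simp only [hs]

/-- Used on the terms of the divergence proportional to the metric, where `l` is the differential of
a coefficient function. -/
theorem trace_contract (hG : G.IsInvertible) (l : E →L[ℝ] ℝ) (w : E) :
    trace G (fun u v => l u * G v w) = l w := by
  simp only [trace, apply_raised hG]
  have h := congrArg l ((Module.finBasis ℝ E).sum_repr w)
  simp only [map_sum, map_smul, smul_eq_mul] at h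
  simp only [← h, mul_comm]

/-- Moving an endomorphism from one slot of a trace to the other. -/
theorem trace_comp_left (A : E →L[ℝ] E) (B : E →L[ℝ] E →L[ℝ] V) :
    trace G (fun u v => B (A u) v) = ∑ i, B (Module.finBasis ℝ E i) (G.inverse
      (LinearMap.toContinuousLinearMap ((Module.finBasis ℝ E).coord i) ∘L A)) := by
  set b := Module.finBasis ℝ E with hb
  have h1 : ∀ i, LinearMap.toContinuousLinearMap (b.coord i) ∘L A =
      ∑ j, b.repr (A (b j)) i • LinearMap.toContinuousLinearMap (b.coord j) := by
    intro i
    ext v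
    have h := congrArg (fun z => b.repr (A z) i) (b.sum_repr v)
    simp only [map_sum, map_smul, Finsupp.coe_finsetSum, Finset.sum_apply, Finsupp.coe_smul,
      Pi.smul_apply, smul_eq_mul] at h
    simp [← h, mul_comm]
  simp only [h1, map_sum, map_smul]
  rw [Finset.sum_comm]
  refine Finset.sum_congr rfl fun j _ => ?_
  have h := congrArg (fun z => B z (raised G j)) (b.sum_repr (A (b j)))
  simp only [map_sum, map_smul, sum_apply, smul_apply] at h
  exact h.symm

theorem trace_add (B C : E → E → V) :
    trace G (fun u v => B u v + C u v) = trace G B + trace G C := Finset.sum_add_distrib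

theorem trace_sub (B C : E → E → V) :
    trace G (fun u v => B u v - C u v) = trace G B - trace G C := Finset.sum_sub_distrib _ _

theorem trace_const_mul (c : ℝ) (B : E → E → ℝ) :
    trace G (fun u v => c * B u v) = c * trace G B := (Finset.mul_sum _ _ _).symm

theorem map_trace {W : Type*} [NormedAddCommGroup W] [NormedSpace ℝ W] (l : V →L[ℝ] W)
    (B : E → E → V) : l (trace G B) = trace G (fun u v => l (B u v)) := map_sum _ _ _

end Linear

variable {G : E → E →L[ℝ] E →L[ℝ] ℝ} {x : E}

theorem contDiffAt_inverse (hG : ContDiffAt ℝ ∞ G x) (hi : (G x).IsInvertible) :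
    ContDiffAt ℝ ∞ (fun z => (G z).inverse) x := by
  have := FiniteDimensional.complete ℝ E
  exact (hi.contDiffAt_map_inverse).comp x hG

theorem contDiffAt_raised (hG : ContDiffAt ℝ ∞ G x) (hi : (G x).IsInvertible)
    (i : Fin (Module.finrank ℝ E)) : ContDiffAt ℝ ∞ (fun z => raised (G z) i) x :=
  (contDiffAt_inverse hG hi).clm_apply contDiffAt_const

theorem contDiffAt_trace (hG : ContDiffAt ℝ ∞ G x) (hi : (G x).IsInvertible)
    {B : E → E →L[ℝ] E →L[ℝ] V} (hB : ContDiffAt ℝ ∞ B x) :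
    ContDiffAt ℝ ∞ (fun z => trace (G z) (fun u v => B z u v)) x :=
  ContDiffAt.sum fun i _ => (hB.clm_apply contDiffAt_const).clm_apply (contDiffAt_raised hG hi i)

theorem eventually_isInvertible (hG : ContinuousAt G x) (hi : (G x).IsInvertible) :
    ∀ᶠ z in nhds x, (G z).IsInvertible := by
  have := FiniteDimensional.complete ℝ E
  obtain ⟨e, he⟩ := hi
  have h := e.nhds
  rw [he] at h
  exact (hG.eventually_mem h).mono fun z hz => hz

/-- The trace commutes with covariant differentiation. -/
theorem fderiv_trace {Γ : E → E →L[ℝ] E →L[ℝ] E} (hG : ContDiffAt ℝ ∞ G x)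
    (hi : (G x).IsInvertible) (hc : MetricCompatAt G Γ x) {B : E → E →L[ℝ] E →L[ℝ] V}
    (hB : ContDiffAt ℝ ∞ B x) (u : E) :
    fderiv ℝ (fun z => trace (G z) (fun v w => B z v w)) x u =
      trace (G x) (fun v w => fderiv ℝ B x u v w - B x (Γ x u v) w - B x v (Γ x u w)) := by
  set b := Module.finBasis ℝ E with hb
  have hBd := differentiableAt_of_smooth hB
  have hGd := differentiableAt_of_smooth hG
  have hr := fun i => differentiableAt_of_smooth (contDiffAt_raised hG hi i)
  -- Differentiate `G z (raised (G z) i) w = b.repr w i`, whose right side is constant. The second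
  -- term is the metric adjoint of `Γ x u` applied to the raised vector; `trace_comp_left` later
  -- moves it to the first slot of the trace.
  have hdr : ∀ i, fderiv ℝ (fun z => raised (G z) i) x u = -Γ x u (raised (G x) i) -
      (G x).inverse (LinearMap.toContinuousLinearMap (b.coord i) ∘L Γ x u) := by
    intro i
    refine eq_of_apply_eq hi fun w => ?_
    have e : (fun z => G z (raised (G z) i) w) =ᶠ[nhds x] fun _ => b.repr w i :=
      (eventually_isInvertible hG.continuousAt hi).mono fun z hz => apply_raised hz i w
    have h1 := ((hGd.hasFDerivAt.clm_apply (hr i).hasFDerivAt).clm_apply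
      (hasFDerivAt_const w x)).fderiv
    have h2 := e.fderiv_eq (𝕜 := ℝ)
    rw [h1, fderiv_fun_const] at h2
    have h3 := congrArg (fun L : E →L[ℝ] ℝ => L u) h2
    simp at h3
    rw [hc, apply_raised hi] at h3
    simp only [map_sub, map_neg, sub_apply, neg_apply, hi.self_apply_inverse]
    simp only [ContinuousLinearMap.comp_apply, LinearMap.coe_toContinuousLinearMap',
      Module.Basis.coord_apply]
    linarith
  have hterm : ∀ i, HasFDerivAt (fun z => B z (b i) (raised (G z) i)) _ x := fun i =>
    ((hBd.hasFDerivAt.clm_apply (hasFDerivAt_const (b i) x)).clm_apply (hr i).hasFDerivAt)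
  have hsum := (HasFDerivAt.fun_sum (u := Finset.univ) fun i _ => hterm i).fderiv
  have hsum' : fderiv ℝ (fun z => trace (G z) (fun v w => B z v w)) x = _ := hsum
  rw [hsum', trace_sub, trace_sub, trace_comp_left (Γ x u) (B x)]
  simp only [trace, ← Finset.sum_sub_distrib, sum_apply]
  refine Finset.sum_congr rfl fun i _ => ?_
  simp [hdr]
  abel

/-! ### Metric compatible connections -/

/-- A trilinear form symmetric in the first two and antisymmetric in the last two slots vanishes. -/
theorem eq_zero_of_symm_of_skew {W : Type*} (a : W → W → W → ℝ) (h : ∀ u v w, a u v w = a v u w)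
    (h' : ∀ u v w, a u v w + a u w v = 0) (u v w : W) : a u v w = 0 := by
  linarith [h u v w, h v w u, h w u v, h' u v w, h' v w u, h' w u v]

/-- Naturality of the Levi-Civita connection coefficients under a local isometry. -/
theorem fderiv_connection_of_isometry [FiniteDimensional ℝ F] {H : F → F →L[ℝ] F →L[ℝ] ℝ}
    {Γ : E → E →L[ℝ] E →L[ℝ] E} {Γ' : F → F →L[ℝ] F →L[ℝ] F} {ψ : E → F}
    (hH : DifferentiableAt ℝ H (ψ x)) (hψ : ContDiffAt ℝ ∞ ψ x)
    (hiso : ∀ᶠ z in nhds x, ∀ u v, G z u v = H (ψ z) (fderiv ℝ ψ z u) (fderiv ℝ ψ z v))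
    (hG : DifferentiableAt ℝ G x) (hHi : (H (ψ x)).IsInvertible) (hHs : ∀ u v, H (ψ x) u v = H (ψ x) v u)
    (hsurj : Function.Surjective (fderiv ℝ ψ x))
    (hΓ : ∀ u v, Γ x u v = Γ x v u) (hΓ' : ∀ u v, Γ' (ψ x) u v = Γ' (ψ x) v u)
    (hc : MetricCompatAt G Γ x) (hc' : MetricCompatAt H Γ' (ψ x)) (u v : E) :
    fderiv ℝ ψ x (Γ x u v) = fderiv ℝ (fderiv ℝ ψ) x u v +
      Γ' (ψ x) (fderiv ℝ ψ x u) (fderiv ℝ ψ x v) := by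
  have hd := differentiableAt_of_smooth (contDiffAt_fderiv hψ)
  have h0 := hiso.self_of_nhds
  -- The form `⟨∇dψ(u, v), dψ(w)⟩` is symmetric in `u, v` by torsion-freeness and skew in `v, w` by
  -- differentiating the isometry relation, so it vanishes. Surjectivity of `dψ` and nondegeneracy
  -- of `H` then give `∇dψ = 0`, which is the transformation law.
  have hz := eq_zero_of_symm_of_skew
    (fun u v w => H (ψ x) (secondFF Γ Γ' ψ x u v) (fderiv ℝ ψ x w)) (fun u v w => by
      rw [secondFF_symm hψ hΓ hΓ']) (by
      intro u v w
      have hv : ∀ v, HasFDerivAt (fun z => fderiv ℝ ψ z v) _ x := fun v =>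
        hd.hasFDerivAt.clm_apply (hasFDerivAt_const v x)
      have e : (fun z => G z v w) =ᶠ[nhds x]
        fun z => H (ψ z) (fderiv ℝ ψ z v) (fderiv ℝ ψ z w) := hiso.mono fun z hz => hz v w
      have h2 := congrArg (fun L : E →L[ℝ] ℝ => L u) (e.fderiv_eq (𝕜 := ℝ))
      rw [fderiv_inner_along hH (differentiableAt_of_smooth hψ) (hv v).differentiableAt
        (hv w).differentiableAt hc', ((hG.hasFDerivAt.clm_apply (hasFDerivAt_const v x)).clm_apply
          (hasFDerivAt_const w x)).fderiv, covDeriv_fderiv_apply (Γ := Γ) hψ,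
        covDeriv_fderiv_apply (Γ := Γ) hψ] at h2
      simp at h2
      rw [hc, h0, h0] at h2
      linarith [hHs (fderiv ℝ ψ x v) (secondFF Γ Γ' ψ x u w)])
  have h1 : secondFF Γ Γ' ψ x u v = 0 := by
    refine eq_of_apply_eq hHi fun w => ?_
    obtain ⟨w, rfl⟩ := hsurj w
    rw [hz u v w]
    simp
  rw [secondFF_apply, sub_eq_zero] at h1
  exact h1.symm

end FlatTrace

/-! ### The divergence computation in coordinates. -/

section FlatDivergence

/-- Near `x`, `G` are the coefficients of a smooth Riemannian (or pseudo-Riemannian) metric and `Γ`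
those of its Levi-Civita connection. -/
structure IsLeviCivitaAt {E : Type*} [NormedAddCommGroup E] [NormedSpace ℝ E]
    (G : E → E →L[ℝ] E →L[ℝ] ℝ) (Γ : E → E →L[ℝ] E →L[ℝ] E) (x : E) : Prop where
  smooth_metric : ContDiffAt ℝ ∞ G x
  smooth_connection : ContDiffAt ℝ ∞ Γ x
  invertible : (G x).IsInvertible
  metric_symm : ∀ u v, G x u v = G x v u
  torsion_free : ∀ᶠ z in nhds x, ∀ u v, Γ z u v = Γ z v u
  compat : ∀ᶠ z in nhds x, MetricCompatAt G Γ z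

variable {E F : Type*} [NormedAddCommGroup E] [NormedSpace ℝ E] [FiniteDimensional ℝ E]
  [NormedAddCommGroup F] [NormedSpace ℝ F] [FiniteDimensional ℝ F]

/-- The pairing `⟨α(u), β(v)⟩` of `F`-valued one-forms along `f`. -/
def pairing (H : F → F →L[ℝ] F →L[ℝ] ℝ) (f : E → F) (α β : E → E →L[ℝ] F) (x : E) :
    E →L[ℝ] E →L[ℝ] ℝ := (H (f x)).bilinearComp (α x) (β x)

theorem pairing_apply (H : F → F →L[ℝ] F →L[ℝ] ℝ) (f : E → F) (α β : E → E →L[ℝ] F) (x u v : E) :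
    pairing H f α β x u v = H (f x) (α x u) (β x v) := rfl

theorem contDiffAt_pairing {H : F → F →L[ℝ] F →L[ℝ] ℝ} {f : E → F} {α β : E → E →L[ℝ] F} {x : E}
    (hH : ContDiffAt ℝ ∞ H (f x)) (hf : ContDiffAt ℝ ∞ f x) (hα : ContDiffAt ℝ ∞ α x)
    (hβ : ContDiffAt ℝ ∞ β x) : ContDiffAt ℝ ∞ (pairing H f α β) x :=
  contDiffAt_clm_of_apply fun _ => contDiffAt_clm_of_apply fun _ =>
    ((hH.comp x hf).clm_apply (hα.clm_apply contDiffAt_const)).clm_apply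
      (hβ.clm_apply contDiffAt_const)

/-- The covariant derivative of a one-form along `f`. -/
def covDerivForm (Γ : E → E →L[ℝ] E →L[ℝ] E) (Γ' : F → F →L[ℝ] F →L[ℝ] F) (f : E → F)
    (α : E → E →L[ℝ] F) (x u v : E) : F :=
  covDeriv Γ' f (fun z => α z v) x u - α x (Γ x u v)

theorem covDerivForm_fderiv {Γ : E → E →L[ℝ] E →L[ℝ] E} {Γ' : F → F →L[ℝ] F →L[ℝ] F} {f : E → F}
    {x : E} (hf : ContDiffAt ℝ ∞ f x) (u v : E) :
    covDerivForm Γ Γ' f (fderiv ℝ f) x u v = secondFF Γ Γ' f x u v := by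
  rw [covDerivForm, covDeriv_fderiv_apply (Γ := Γ) hf, add_sub_cancel_right]

/-- The Leibniz rule for the induced connections. `Γ` can be arbitrary because its terms agree
identically on both sides; only compatibility of `H` with `Γ'` enters. -/
theorem fderiv_pairing {H : F → F →L[ℝ] F →L[ℝ] ℝ} {Γ : E → E →L[ℝ] E →L[ℝ] E}
    {Γ' : F → F →L[ℝ] F →L[ℝ] F} {f : E → F} {α β : E → E →L[ℝ] F} {x : E}
    (hH : ContDiffAt ℝ ∞ H (f x)) (hf : ContDiffAt ℝ ∞ f x) (hα : ContDiffAt ℝ ∞ α x)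
    (hβ : ContDiffAt ℝ ∞ β x) (hc : MetricCompatAt H Γ' (f x)) (u v w : E) :
    fderiv ℝ (pairing H f α β) x u v w - pairing H f α β x (Γ x u v) w -
      pairing H f α β x v (Γ x u w) =
    H (f x) (covDerivForm Γ Γ' f α x u v) (β x w) +
      H (f x) (α x v) (covDerivForm Γ Γ' f β x u w) := by
  have hp := differentiableAt_of_smooth (contDiffAt_pairing hH hf hα hβ)
  have h1 := ((hp.hasFDerivAt.clm_apply (hasFDerivAt_const v x)).clm_apply
    (hasFDerivAt_const w x)).fderiv
  have h2 := fderiv_inner_along (differentiableAt_of_smooth hH) (differentiableAt_of_smooth hf)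
    (differentiableAt_of_smooth (hα.clm_apply (contDiffAt_const (c := v))))
    (differentiableAt_of_smooth (hβ.clm_apply (contDiffAt_const (c := w)))) hc u
  have h3 : fderiv ℝ (pairing H f α β) x u v w =
      fderiv ℝ (fun z => H (f z) (α z v) (β z w)) x u := by
    have h4 := congrArg (fun L : E →L[ℝ] ℝ => L u) h1
    simp at h4
    exact h4.symm
  rw [h3, h2]
  simp only [pairing_apply, covDerivForm, map_sub, sub_apply]
  ring

/-- The derivative of the trace of a pairing of one-forms along `f`. -/
theorem fderiv_trace_pairing {G : E → E →L[ℝ] E →L[ℝ] ℝ} {H : F → F →L[ℝ] F →L[ℝ] ℝ}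
    {Γ : E → E →L[ℝ] E →L[ℝ] E}
    {Γ' : F → F →L[ℝ] F →L[ℝ] F} {f : E → F} {α β : E → E →L[ℝ] F} {x : E}
    (hG : IsLeviCivitaAt G Γ x)
    (hH : ContDiffAt ℝ ∞ H (f x)) (hf : ContDiffAt ℝ ∞ f x) (hα : ContDiffAt ℝ ∞ α x)
    (hβ : ContDiffAt ℝ ∞ β x) (hc : MetricCompatAt H Γ' (f x)) (u : E) :
    fderiv ℝ (fun z => trace (G z) (fun v w => H (f z) (α z v) (β z w))) x u =
      trace (G x) (fun v w => H (f x) (covDerivForm Γ Γ' f α x u v) (β x w)) +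
      trace (G x) (fun v w => H (f x) (α x v) (covDerivForm Γ Γ' f β x u w)) := by
  have h := fderiv_trace hG.smooth_metric hG.invertible hG.compat.self_of_nhds
    (contDiffAt_pairing hH hf hα hβ) u
  rw [← trace_add]
  simp only [fderiv_pairing hH hf hα hβ hc] at h
  exact h

/-- The energy-momentum tensor in coordinates. -/
def stress (G : E → E →L[ℝ] E →L[ℝ] ℝ) (H : F → F →L[ℝ] F →L[ℝ] ℝ) (Γ' : F → F →L[ℝ] F →L[ℝ] F)
    (f τ : E → F) (δ₁ δ₂ : ℝ) (x : E) : E →L[ℝ] E →L[ℝ] ℝ :=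
  δ₁ • (pairing H f (fderiv ℝ f) (fderiv ℝ f) x -
    (1 / 2 * trace (G x) (fun u v => H (f x) (fderiv ℝ f x u) (fderiv ℝ f x v))) • G x) +
  δ₂ • ((1 / 2 * H (f x) (τ x) (τ x)) • G x +
    trace (G x) (fun u v => H (f x) (fderiv ℝ f x u) (covDeriv Γ' f τ x v)) • G x -
    pairing H f (fderiv ℝ f) (covDeriv Γ' f τ) x -
    (pairing H f (fderiv ℝ f) (covDeriv Γ' f τ) x).flip)

variable {G : E → E →L[ℝ] E →L[ℝ] ℝ} {H : F → F →L[ℝ] F →L[ℝ] ℝ} {Γ : E → E →L[ℝ] E →L[ℝ] E}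
  {Γ' : F → F →L[ℝ] F →L[ℝ] F} {f τ : E → F} {x : E}

theorem contDiffAt_trace_pairing {α β : E → E →L[ℝ] F} (hG : IsLeviCivitaAt G Γ x)
    (hH : ContDiffAt ℝ ∞ H (f x)) (hf : ContDiffAt ℝ ∞ f x) (hα : ContDiffAt ℝ ∞ α x)
    (hβ : ContDiffAt ℝ ∞ β x) :
    ContDiffAt ℝ ∞ (fun z => trace (G z) (fun v w => H (f z) (α z v) (β z w))) x :=
  contDiffAt_trace hG.smooth_metric hG.invertible (contDiffAt_pairing hH hf hα hβ)

/-- The covariant derivative of the energy-momentum tensor. -/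
theorem covDeriv_stress (hG : IsLeviCivitaAt G Γ x) (hH : IsLeviCivitaAt H Γ' (f x))
    (hf : ContDiffAt ℝ ∞ f x) (hτ : ContDiffAt ℝ ∞ τ x) (δ₁ δ₂ : ℝ) (u v w : E) :
    DifferentiableAt ℝ (fun z => stress G H Γ' f τ δ₁ δ₂ z v w) x ∧
    fderiv ℝ (fun z => stress G H Γ' f τ δ₁ δ₂ z v w) x u -
      stress G H Γ' f τ δ₁ δ₂ x (Γ x u v) w - stress G H Γ' f τ δ₁ δ₂ x v (Γ x u w) =
    δ₁ * (H (f x) (secondFF Γ Γ' f x u v) (fderiv ℝ f x w) +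
        H (f x) (fderiv ℝ f x v) (secondFF Γ Γ' f x u w) -
        1 / 2 * fderiv ℝ (fun z => trace (G z)
          (fun a b => H (f z) (fderiv ℝ f z a) (fderiv ℝ f z b))) x u * G x v w) +
      δ₂ * (H (f x) (τ x) (covDeriv Γ' f τ x u) * G x v w +
        fderiv ℝ (fun z => trace (G z)
          (fun a b => H (f z) (fderiv ℝ f z a) (covDeriv Γ' f τ z b))) x u * G x v w -
        H (f x) (secondFF Γ Γ' f x u v) (covDeriv Γ' f τ x w) -
        H (f x) (fderiv ℝ f x v) (covDeriv₂ Γ Γ' f τ x u w) -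
        H (f x) (secondFF Γ Γ' f x u w) (covDeriv Γ' f τ x v) -
        H (f x) (fderiv ℝ f x w) (covDeriv₂ Γ Γ' f τ x u v)) := by
  have hc := hH.compat.self_of_nhds
  have hHs := hH.smooth_metric
  have hd := contDiffAt_fderiv hf
  have hn := contDiffAt_covDeriv hH.smooth_connection hf hτ
  have he := (differentiableAt_of_smooth (contDiffAt_trace_pairing hG hHs hf hd hd)).hasFDerivAt
  have hk := (differentiableAt_of_smooth (contDiffAt_trace_pairing hG hHs hf hd hn)).hasFDerivAt
  have h2 : ∀ a b, covDerivForm Γ Γ' f (covDeriv Γ' f τ) x a b = covDeriv₂ Γ Γ' f τ x a b :=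
    fun a b => (covDeriv₂_apply (differentiableAt_of_smooth hn) a b).symm
  have hGv : HasFDerivAt (fun z => G z v w) _ x :=
    ((differentiableAt_of_smooth hG.smooth_metric).hasFDerivAt.clm_apply
      (hasFDerivAt_const v x)).clm_apply (hasFDerivAt_const w x)
  have hp : ∀ {β} (_ : ContDiffAt ℝ ∞ β x) (v w : E),
      HasFDerivAt (fun z => pairing H f (fderiv ℝ f) β z v w) _ x := fun hβ v w =>
    ((differentiableAt_of_smooth (contDiffAt_pairing hHs hf hd hβ)).hasFDerivAt.clm_apply
      (hasFDerivAt_const v x)).clm_apply (hasFDerivAt_const w x)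
  have ht : HasFDerivAt (fun z => H (f z) (τ z) (τ z))
      (fderiv ℝ (fun z => H (f z) (τ z) (τ z)) x) x :=
    (differentiableAt_of_smooth (((hHs.comp x hf).clm_apply hτ).clm_apply hτ)).hasFDerivAt
  have hT : HasFDerivAt (fun z => stress G H Γ' f τ δ₁ δ₂ z v w) _ x :=
    (((hp hd v w).sub ((he.const_mul (1 / 2)).mul hGv)).const_mul δ₁).add
      ((((((ht.const_mul (1 / 2)).mul hGv).add (hk.mul hGv)).sub (hp hn v w)).sub
        (hp hn w v)).const_mul δ₂)
  refine ⟨hT.differentiableAt, ?_⟩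
  -- Since `G` is parallel, each product of a function with `G` contributes only the derivative of
  -- the function.
  have hGc := hG.compat.self_of_nhds u v w
  have e1 := fderiv_pairing (Γ := Γ) hHs hf hd hd hc u v w
  have e2 := fderiv_pairing (Γ := Γ) hHs hf hd hn hc u v w
  have e3 := fderiv_pairing (Γ := Γ) hHs hf hd hn hc u w v
  have e4 := fderiv_inner_along (differentiableAt_of_smooth hHs) (differentiableAt_of_smooth hf)
    (differentiableAt_of_smooth hτ) (differentiableAt_of_smooth hτ) hc u
  rw [hH.metric_symm (covDeriv Γ' f τ x u)] at e4
  simp only [covDerivForm_fderiv hf, h2] at e1 e2 e3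
  rw [hT.fderiv]
  simp [stress, hGc, e4]
  linear_combination δ₁ * e1 - δ₂ * e2 - δ₂ * e3

/-- Solutions of the Euler-Lagrange equation have divergence-free energy-momentum tensor. -/
theorem divergence_stress (hG : IsLeviCivitaAt G Γ x) (hH : IsLeviCivitaAt H Γ' (f x))
    (hf : ContDiffAt ℝ ∞ f x) (hτ : ContDiffAt ℝ ∞ τ x) (δ₁ δ₂ : ℝ)
    (hτx : τ x = trace (G x) (fun u v => secondFF Γ Γ' f x u v))
    (hEL : δ₂ • trace (G x) (fun u v => covDeriv₂ Γ Γ' f τ x u v) =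
      δ₂ • trace (G x) (fun u v => curv Γ' (f x) (fderiv ℝ f x u) (τ x) (fderiv ℝ f x v)) +
        δ₁ • τ x) (w : E) :
    trace (G x) (fun u v => fderiv ℝ (fun z => stress G H Γ' f τ δ₁ δ₂ z v w) x u -
      stress G H Γ' f τ δ₁ δ₂ x (Γ x u v) w - stress G H Γ' f τ δ₁ δ₂ x v (Γ x u w)) = 0 := by
  have hc := hH.compat.self_of_nhds
  have hHs := hH.smooth_metric
  have hd := contDiffAt_fderiv hf
  have hn := contDiffAt_covDeriv hH.smooth_connection hf hτ
  have hsym := hH.metric_symm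
  have hΓ := hG.torsion_free.self_of_nhds
  have hS := fun u v => secondFF_symm hf hΓ hH.torsion_free.self_of_nhds u v
  have h2 : ∀ a b, covDerivForm Γ Γ' f (covDeriv Γ' f τ) x a b = covDeriv₂ Γ Γ' f τ x a b :=
    fun a b => (covDeriv₂_apply (differentiableAt_of_smooth hn) a b).symm
  have hsw := fun B : E →L[ℝ] E →L[ℝ] ℝ => trace_swap hG.invertible hG.metric_symm B
  simp only [(covDeriv_stress hG hH hf hτ δ₁ δ₂ _ _ w).2]
  simp only [trace_add, trace_sub, trace_const_mul, mul_assoc]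
  -- Tracing a differential times `G` evaluates the differential at `w`; this handles all terms with
  -- a metric factor.
  have c1 := trace_contract hG.invertible (fderiv ℝ (fun z => trace (G z)
          (fun a b => H (f z) (fderiv ℝ f z a) (fderiv ℝ f z b))) x) w
  have c2 := trace_contract hG.invertible (fderiv ℝ (fun z => trace (G z)
          (fun a b => H (f z) (fderiv ℝ f z a) (covDeriv Γ' f τ z b))) x) w
  have c3 := trace_contract hG.invertible (H (f x) (τ x) ∘L covDeriv Γ' f τ x) w
  simp only [ContinuousLinearMap.comp_apply] at c3
  rw [c1, c2, c3, fderiv_trace_pairing hG hHs hf hd hd hc, fderiv_trace_pairing hG hHs hf hd hn hc]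
  simp only [covDerivForm_fderiv hf, h2]
  -- traces against a fixed vector
  have t1 : ∀ z : F, trace (G x) (fun u v => H (f x) (secondFF Γ Γ' f x u v) z) = H (f x) (τ x) z := by
    intro z
    rw [hτx, hsym _ z, map_trace]
    simp only [hsym z]
  have t2 : trace (G x) (fun u v => H (f x) (fderiv ℝ f x w) (covDeriv₂ Γ Γ' f τ x u v)) =
      H (f x) (fderiv ℝ f x w) (trace (G x) (fun u v => covDeriv₂ Γ Γ' f τ x u v)) :=
    (map_trace _ _).symm
  have t3 := congrArg (H (f x) (fderiv ℝ f x w)) hEL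
  simp only [map_add, map_smul, smul_eq_mul, map_trace] at t3
  -- the terms quadratic in `df`
  have s1 : trace (G x) (fun u v => H (f x) (fderiv ℝ f x v) (secondFF Γ Γ' f x u w)) =
      trace (G x) (fun u v => H (f x) (fderiv ℝ f x u) (secondFF Γ Γ' f x w v)) := by
    refine Eq.trans ?_ (hsw ((H (f x)).bilinearComp (fderiv ℝ f x) (secondFF Γ Γ' f x w)))
    simp only [ContinuousLinearMap.bilinearComp_apply, hS w]
  have s2 : trace (G x) (fun u v => H (f x) (secondFF Γ Γ' f x w u) (fderiv ℝ f x v)) =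
      trace (G x) (fun u v => H (f x) (fderiv ℝ f x u) (secondFF Γ Γ' f x w v)) := by
    refine Eq.trans ?_ (hsw ((H (f x)).bilinearComp (fderiv ℝ f x) (secondFF Γ Γ' f x w)))
    simp only [ContinuousLinearMap.bilinearComp_apply, hsym (fderiv ℝ f x _)]
  have s3 : trace (G x) (fun u v => H (f x) (fderiv ℝ f x v) (covDeriv₂ Γ Γ' f τ x u w)) =
      trace (G x) (fun u v => H (f x) (fderiv ℝ f x u) (covDeriv₂ Γ Γ' f τ x v w)) := by
    exact hsw ((H (f x)).bilinearComp (fderiv ℝ f x) ((covDeriv₂ Γ Γ' f τ x).flip w))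
  -- The only place where curvature enters, through the Ricci identity. The subsequent curvature
  -- identity holds for each `u, v`, before tracing: pair symmetry brings `⟨R(df u, τ) df v, df w⟩`
  -- to `⟨R(df v, df w) df u, τ⟩`, and skewness does the rest.
  have r : trace (G x) (fun u v => H (f x) (fderiv ℝ f x u) (covDeriv₂ Γ Γ' f τ x w v)) -
      trace (G x) (fun u v => H (f x) (fderiv ℝ f x u) (covDeriv₂ Γ Γ' f τ x v w)) =
      trace (G x) (fun u v => H (f x) (fderiv ℝ f x w)
        (curv Γ' (f x) (fderiv ℝ f x u) (τ x) (fderiv ℝ f x v))) := by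
    rw [← trace_sub]
    congr 1
    ext u v
    have hcd := differentiableAt_of_smooth hH.smooth_connection
    rw [← map_sub, covDeriv₂_sub_swap hΓ hH.smooth_connection hf hτ, hsym (fderiv ℝ f x w),
      curv_pair_symm hHs hsym hcd hH.torsion_free hH.compat, hsym (fderiv ℝ f x u), curv_swap,
      map_neg, neg_apply]
    linarith [curv_skew hHs hcd hH.compat (fderiv ℝ f x v) (fderiv ℝ f x w) (fderiv ℝ f x u) (τ x),
      hsym (fderiv ℝ f x u) (curv Γ' (f x) (fderiv ℝ f x v) (fderiv ℝ f x w) (τ x))]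
  have s4 : trace (G x) (fun u v => H (f x) (secondFF Γ Γ' f x u w) (covDeriv Γ' f τ x v)) =
    trace (G x) (fun u v => H (f x) (secondFF Γ Γ' f x w u) (covDeriv Γ' f τ x v)) := by
    simp only [hS w]
  -- After these substitutions the first-order terms cancel. The commutator `r` and the
  -- Euler-Lagrange equation paired with `df(w)`, which is `t3`, account for the remainder.
  rw [t1, t1, t2, s1, s2, s3, s4, map_trace]
  rw [hsym (τ x) (fderiv ℝ f x w)]
  linear_combination δ₂ * r - t3

end FlatDivergence

/-! ### Functions, vectors and maps in arbitrary charts. -/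

section Charts

variable {E : Type*} [NormedAddCommGroup E] [NormedSpace ℝ E]
  {M : Type*} [TopologicalSpace M] [ChartedSpace E M] [IsManifold 𝓘(ℝ, E) ∞ M]
  {F : Type*} [NormedAddCommGroup F] [NormedSpace ℝ F]
  {N : Type*} [TopologicalSpace N] [ChartedSpace F N] [IsManifold 𝓘(ℝ, F) ∞ N]

/-- The preferred chart around `p`, as a partial equivalence with the model vector space. -/
abbrev chart (E : Type*) [NormedAddCommGroup E] [NormedSpace ℝ E]
    {M : Type*} [TopologicalSpace M] [ChartedSpace E M] (p : M) : PartialEquiv M E :=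
  extChartAt 𝓘(ℝ, E) p

theorem mem_trivialization_baseSet {p q : M} (hq : q ∈ (chart E p).source) :
    q ∈ (trivializationAt E (fun x : M => TangentSpace 𝓘(ℝ, E) x) p).baseSet := by
  rw [extChartAt_source] at hq
  rwa [TangentBundle.trivializationAt_baseSet]

theorem ofCoord_toCoord_of_mem {p q : M} (hq : q ∈ (chart E p).source) (v : T E q) :
    ofCoord p q (toCoord p q v) = v :=
  Bundle.Trivialization.symmL_continuousLinearMapAt _ (mem_trivialization_baseSet hq) v

theorem toCoord_ofCoord_of_mem {p q : M} (hq : q ∈ (chart E p).source) (v : E) :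
    toCoord p q (ofCoord p q v) = v :=
  Bundle.Trivialization.continuousLinearMapAt_symmL _ (mem_trivialization_baseSet hq) v

theorem constField_eq {p q : M} (v : T E p) (hq : q ∈ (chart E p).source) :
    constField v q = ofCoord p q (toCoord p p v) := by
  have h1 := mem_trivialization_baseSet hq
  have h2 := mem_trivialization_baseSet (mem_extChartAt_source (I := 𝓘(ℝ, E)) p)
  unfold constField ofCoord toCoord FiberBundle.extend
  rw [Bundle.Trivialization.symmL_apply _ h1,
    Bundle.Trivialization.continuousLinearMapAt_apply_of_mem _ _ h2]

theorem toCoord_eq_mfderiv {p q : M} (hq : q ∈ (chart E p).source) :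
    toCoord p q = mfderiv 𝓘(ℝ, E) 𝓘(ℝ, E) (chart E p) q := by
  rw [extChartAt_source] at hq
  exact TangentBundle.continuousLinearMapAt_trivializationAt hq

theorem isOpen_chart_target (p : M) : IsOpen (chart E p).target := isOpen_extChartAt_target p

theorem chart_mem_target {p q : M} (hq : q ∈ (chart E p).source) :
    chart E p q ∈ (chart E p).target := (chart E p).map_source hq

theorem mdifferentiableAt_chart {p q : M} (hq : q ∈ (chart E p).source) :
    MDifferentiableAt 𝓘(ℝ, E) 𝓘(ℝ, E) (chart E p) q := by
  rw [extChartAt_source] at hq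
  exact mdifferentiableAt_extChartAt hq

theorem contMDiffAt_chart {p q : M} (hq : q ∈ (chart E p).source) :
    ContMDiffAt 𝓘(ℝ, E) 𝓘(ℝ, E) ∞ (chart E p) q := by
  rw [extChartAt_source] at hq
  exact contMDiffAt_extChartAt' hq

theorem contMDiffAt_chart_symm {p : M} {x : E} (hx : x ∈ (chart E p).target) :
    ContMDiffAt 𝓘(ℝ, E) 𝓘(ℝ, E) ∞ (chart E p).symm x :=
  (contMDiffOn_extChartAt_symm p).contMDiffAt ((isOpen_chart_target p).mem_nhds hx)

theorem mdifferentiableAt_chart_symm {p : M} {x : E} (hx : x ∈ (chart E p).target) :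
    MDifferentiableAt 𝓘(ℝ, E) 𝓘(ℝ, E) (chart E p).symm x :=
  (contMDiffAt_chart_symm hx).mdifferentiableAt (by simp)

theorem tendsto_chart_symm {p q : M} (hq : q ∈ (chart E p).source) :
    Filter.Tendsto (chart E p).symm (nhds (chart E p q)) (nhds q) := by
  have := (contMDiffAt_chart_symm (chart_mem_target hq)).continuousAt
  rwa [ContinuousAt, (chart E p).left_inv hq] at this

theorem tendsto_chart {p q : M} (hq : q ∈ (chart E p).source) :
    Filter.Tendsto (chart E p) (nhds q) (nhds (chart E p q)) :=
  (contMDiffAt_chart hq).continuousAt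

theorem eventually_mem_source {p q : M} (hq : q ∈ (chart E p).source) :
    ∀ᶠ z in nhds q, z ∈ (chart E p).source := (isOpen_extChartAt_source p).mem_nhds hq

/-! ### Functions with values in a vector space -/

variable {V : Type*} [NormedAddCommGroup V] [NormedSpace ℝ V]

theorem mdifferentiableAt_iff_chart {p q : M} (hq : q ∈ (chart E p).source) {s : M → V} :
    MDifferentiableAt 𝓘(ℝ, E) 𝓘(ℝ, V) s q ↔
      DifferentiableAt ℝ (fun x => s ((chart E p).symm x)) (chart E p q) := by
  rw [← mdifferentiableAt_iff_differentiableAt]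
  constructor
  · intro h
    refine MDifferentiableAt.comp (I' := 𝓘(ℝ, E)) (chart E p q) ?_
      (mdifferentiableAt_chart_symm (chart_mem_target hq))
    rwa [(chart E p).left_inv hq]
  · intro h
    have h1 := MDifferentiableAt.comp q h (mdifferentiableAt_chart hq)
    refine h1.congr_of_eventuallyEq ?_
    filter_upwards [eventually_mem_source hq] with z hz
    simp only [Function.comp_apply, (chart E p).left_inv hz]

/-- The vector `ofCoord p q v` is the coordinate vector `v` at `q`, for every `q` in the chart
around `p` and not only for its center. This freedom is needed to differentiate a second time. -/
theorem mvfderiv_ofCoord {p q : M} (hq : q ∈ (chart E p).source) {s : M → V}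
    (hs : MDifferentiableAt 𝓘(ℝ, E) 𝓘(ℝ, V) s q) (v : E) :
    mvfderiv 𝓘(ℝ, E) s q (ofCoord p q v) =
      fderiv ℝ (fun x => s ((chart E p).symm x)) (chart E p q) v := by
  have hd : MDifferentiableAt 𝓘(ℝ, E) 𝓘(ℝ, V) (fun x => s ((chart E p).symm x)) (chart E p q) :=
    mdifferentiableAt_iff_differentiableAt.mpr ((mdifferentiableAt_iff_chart hq).mp hs)
  have he : s =ᶠ[nhds q] (fun x => s ((chart E p).symm x)) ∘ chart E p := by
    filter_upwards [eventually_mem_source hq] with z hz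
    simp only [Function.comp_apply, (chart E p).left_inv hz]
  have h1 : mfderiv 𝓘(ℝ, E) 𝓘(ℝ, V) s q = mfderiv 𝓘(ℝ, E) 𝓘(ℝ, V)
      ((fun x => s ((chart E p).symm x)) ∘ chart E p) q := he.mfderiv_eq
  have h2 := mfderiv_comp q hd (mdifferentiableAt_chart hq)
  have h3 : (toCoord p q (ofCoord p q v) : E) = v := toCoord_ofCoord_of_mem hq v
  rw [← toCoord_eq_mfderiv hq, mfderiv_eq_fderiv] at h2
  have h4 := congrArg (fun L : E →L[ℝ] V => L (ofCoord p q v)) (h1.trans h2)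
  refine h4.trans ?_
  exact congrArg (fderiv ℝ (fun x => s ((chart E p).symm x)) (chart E p q)) h3

/-! ### Maps between manifolds -/

/-- The coordinate representation of `φ` in the charts around `p` and `y`. -/
def mapRep (E F : Type*) [NormedAddCommGroup E] [NormedSpace ℝ E] [NormedAddCommGroup F]
    [NormedSpace ℝ F] {M : Type*} [TopologicalSpace M] [ChartedSpace E M]
    {N : Type*} [TopologicalSpace N] [ChartedSpace F N] (φ : M → N) (p : M) (y : N) (x : E) : F :=
  chart F y (φ ((chart E p).symm x))

theorem mapRep_chart (φ : M → N) {p q : M} (y : N) (hq : q ∈ (chart E p).source) :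
    mapRep E F φ p y (chart E p q) = chart F y (φ q) := by
  rw [mapRep, (chart E p).left_inv hq]

theorem contDiffAt_mapRep {φ : M → N} (hφ : ContMDiff 𝓘(ℝ, E) 𝓘(ℝ, F) ∞ φ) {p q : M} {y : N}
    (hq : q ∈ (chart E p).source) (hy : φ q ∈ (chart F y).source) :
    ContDiffAt ℝ ∞ (mapRep E F φ p y) (chart E p q) := by
  rw [← contMDiffAt_iff_contDiffAt]
  have h1 := contMDiffAt_chart_symm (chart_mem_target hq)
  have h2 : ContMDiffAt 𝓘(ℝ, F) 𝓘(ℝ, F) ∞ (chart F y) (φ ((chart E p).symm (chart E p q))) := by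
    rw [(chart E p).left_inv hq]
    exact contMDiffAt_chart hy
  have h3 : ContMDiffAt 𝓘(ℝ, E) 𝓘(ℝ, F) ∞ (φ ∘ (chart E p).symm) (chart E p q) :=
    hφ.contMDiffAt.comp (I' := 𝓘(ℝ, E)) (chart E p q) h1
  exact ContMDiffAt.comp (I' := 𝓘(ℝ, F)) (chart E p q) h2 h3

theorem toCoord_diff {φ : M → N} (hφ : ContMDiff 𝓘(ℝ, E) 𝓘(ℝ, F) ∞ φ) {p q : M} {y : N}
    (hq : q ∈ (chart E p).source) (hy : φ q ∈ (chart F y).source) (v : E) :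
    toCoord y (φ q) (diff E F φ q (ofCoord p q v)) =
      fderiv ℝ (mapRep E F φ p y) (chart E p q) v := by
  have hφq := hφ.mdifferentiableAt (by simp) (x := q)
  have h1 : MDifferentiableAt 𝓘(ℝ, E) 𝓘(ℝ, F) (chart F y ∘ φ) q :=
    (mdifferentiableAt_chart hy).comp q hφq
  rw [toCoord_eq_mfderiv hy]
  have h2 := mvfderiv_ofCoord hq h1 v
  have h3 : mfderiv 𝓘(ℝ, E) 𝓘(ℝ, F) (chart F y ∘ φ) q = _ :=
    mfderiv_comp q (mdifferentiableAt_chart hy) hφq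
  refine Eq.trans ?_ h2
  exact (congrArg (fun L : T E q →L[ℝ] F => L (ofCoord p q v)) h3).symm

theorem diff_ofCoord {φ : M → N} (hφ : ContMDiff 𝓘(ℝ, E) 𝓘(ℝ, F) ∞ φ) {p q : M} {y : N}
    (hq : q ∈ (chart E p).source) (hy : φ q ∈ (chart F y).source) (v : E) :
    diff E F φ q (ofCoord p q v) =
      ofCoord y (φ q) (fderiv ℝ (mapRep E F φ p y) (chart E p q) v) := by
  rw [← toCoord_diff hφ hq hy, ofCoord_toCoord_of_mem hy]

/-- The change of coordinates from the chart around `p` to the chart around `p'`. -/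
abbrev transition (E : Type*) [NormedAddCommGroup E] [NormedSpace ℝ E]
    {M : Type*} [TopologicalSpace M] [ChartedSpace E M] (p p' : M) : E → E :=
  mapRep E E id p p'

theorem contDiffAt_transition {p p' q : M} (hq : q ∈ (chart E p).source)
    (hq' : q ∈ (chart E p').source) : ContDiffAt ℝ ∞ (transition E p p') (chart E p q) :=
  contDiffAt_mapRep contMDiff_id hq hq'

theorem toCoord_ofCoord {p p' q : M} (hq : q ∈ (chart E p).source)
    (hq' : q ∈ (chart E p').source) (v : E) :
    toCoord p' q (ofCoord p q v) = fderiv ℝ (transition E p p') (chart E p q) v := by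
  rw [← toCoord_diff contMDiff_id hq (by exact hq')]
  rw [diff, mfderiv_id]
  rfl

theorem mapRep_self_eventuallyEq {p q : M} (hq : q ∈ (chart E p).source) :
    transition E p p =ᶠ[nhds (chart E p q)] id := by
  filter_upwards [(isOpen_chart_target p).mem_nhds (chart_mem_target hq)] with x hx
  exact (chart E p).right_inv hx

end Charts

/-! ### Coordinate metrics, Christoffel symbols and their transformation law. -/

section MetricInChart

variable {E : Type*} [NormedAddCommGroup E] [NormedSpace ℝ E] [FiniteDimensional ℝ E]
  {M : Type*} [TopologicalSpace M] [ChartedSpace E M] [IsManifold 𝓘(ℝ, E) ∞ M]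

theorem metricInChart_apply (g : Metric E M) (p : M) (x u v : E) :
    metricInChart g p x u v = g.inner ((chart E p).symm x) (ofCoord p ((chart E p).symm x) u)
      (ofCoord p ((chart E p).symm x) v) := rfl

theorem metricInChart_chart (g : Metric E M) {p q : M} (hq : q ∈ (chart E p).source) (u v : E) :
    metricInChart g p (chart E p q) u v = g.inner q (ofCoord p q u) (ofCoord p q v) := by
  rw [metricInChart_apply, (chart E p).left_inv hq]

theorem contMDiffAt_ofCoord {p q : M} (hq : q ∈ (chart E p).source) (v : E) :
    ContMDiffAt 𝓘(ℝ, E) (𝓘(ℝ, E).prod 𝓘(ℝ, E)) ∞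
      (fun z => Bundle.TotalSpace.mk' E z (ofCoord p z v : TangentSpace 𝓘(ℝ, E) z)) q := by
  rw [(trivializationAt E (fun x : M => TangentSpace 𝓘(ℝ, E) x) p).contMDiffAt_section_iff
    (mem_trivialization_baseSet hq)]
  have h : ContMDiffAt 𝓘(ℝ, E) 𝓘(ℝ, E) ∞ (fun _ : M => v) q := contMDiffAt_const
  refine h.congr_of_eventuallyEq ?_
  filter_upwards [eventually_mem_source hq] with z hz
  have h1 := toCoord_ofCoord_of_mem hz v
  rwa [toCoord, Bundle.Trivialization.continuousLinearMapAt_apply_of_mem _ _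
    (mem_trivialization_baseSet hz)] at h1

theorem contDiffAt_metricInChart (g : Metric E M) {p q : M} (hq : q ∈ (chart E p).source) :
    ContDiffAt ℝ ∞ (metricInChart g p) (chart E p q) := by
  refine contDiffAt_clm_of_apply fun u => contDiffAt_clm_of_apply fun v => ?_
  have h : ContMDiffAt 𝓘(ℝ, E) (𝓘(ℝ, E).prod 𝓘(ℝ, ℝ)) ∞
      (fun z => Bundle.TotalSpace.mk' ℝ (E := Bundle.Trivial M ℝ) z
        (g.inner z (ofCoord p z u) (ofCoord p z v))) q := by
    apply ContMDiffAt.clm_bundle_apply₂ (F₁ := E) (F₂ := E)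
    · exact g.contMDiff.contMDiffAt
    · exact contMDiffAt_ofCoord hq u
    · exact contMDiffAt_ofCoord hq v
  rw [Bundle.contMDiffAt_totalSpace] at h
  have h2 : ContMDiffAt 𝓘(ℝ, E) 𝓘(ℝ, ℝ) ∞
    (fun z : M => g.inner z (ofCoord p z u) (ofCoord p z v)) q := h.2
  rw [← (chart E p).left_inv hq] at h2
  exact (ContMDiffAt.comp (I' := 𝓘(ℝ, E)) (chart E p q) h2
    (contMDiffAt_chart_symm (chart_mem_target hq))).contDiffAt

theorem metricInChart_symm (g : Metric E M) (p : M) (x u v : E) :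
    metricInChart g p x u v = metricInChart g p x v u := g.symm _ _ _

theorem isInvertible_metricInChart (g : Metric E M) {p q : M} (hq : q ∈ (chart E p).source) :
    (metricInChart g p (chart E p q)).IsInvertible := by
  have hinj : Function.Injective (metricInChart g p (chart E p q) : E →ₗ[ℝ] (E →L[ℝ] ℝ)) := by
    rw [injective_iff_map_eq_zero]
    intro v hv
    by_contra h0
    have h1 : ofCoord p q v ≠ 0 := by
      intro h
      apply h0
      have := toCoord_ofCoord_of_mem hq v
      rw [h, map_zero] at this
      exact this.symm
    have h2 := g.pos q _ h1
    rw [← metricInChart_chart g hq] at h2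
    have h3 : metricInChart g p (chart E p q) v = 0 := hv
    rw [h3] at h2
    exact lt_irrefl _ h2
  let D : (E →ₗ[ℝ] ℝ) ≃ₗ[ℝ] (E →L[ℝ] ℝ) := LinearMap.toContinuousLinearMap
  have hfin : FiniteDimensional ℝ (E →L[ℝ] ℝ) := D.finiteDimensional
  have hdim : Module.finrank ℝ E = Module.finrank ℝ (E →L[ℝ] ℝ) := by
    rw [← D.finrank_eq]
    exact Subspace.dual_finrank_eq.symm
  exact ⟨(LinearEquiv.ofInjectiveOfFinrankEq _ hinj hdim).toContinuousLinearEquiv, by ext; rfl⟩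

/-- The Christoffel symbols in the chart around `p`. -/
def connection (g : Metric E M) (p : M) (x : E) : E →L[ℝ] E →L[ℝ] E :=
  (christoffel g p x).toContinuousBilinearMap

theorem connection_eq_sum (g : Metric E M) (p : M) (x u v : E) :
    connection g p x u v = ∑ l, christoffelLower g p x u v (Module.finBasis ℝ E l) •
      raised (metricInChart g p x) l := rfl

/-- Lowering the index undoes the multiplication by `g^{kl}`. It suffices to expand `w` in the
basis, because the symbols of the first kind are linear in their last argument. -/
theorem metricInChart_connection (g : Metric E M) {p q : M} (hq : q ∈ (chart E p).source)
    (u v w : E) : metricInChart g p (chart E p q) (connection g p (chart E p q) u v) w =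
      christoffelLower g p (chart E p q) u v w := by
  have hw : christoffelLower g p (chart E p q) u v w =
      ∑ l, (Module.finBasis ℝ E).repr w l *
        christoffelLower g p (chart E p q) u v (Module.finBasis ℝ E l) := by
    have h := (Module.finBasis ℝ E).sum_repr w
    let L : E →ₗ[ℝ] ℝ :=
      { toFun := christoffelLower g p (chart E p q) u v
        map_add' := by intro a b; simp only [christoffelLower, map_add, add_apply]; ring
        map_smul' := by
          intro a b
          simp only [christoffelLower, map_smul, smul_apply, smul_eq_mul, RingHom.id_apply]
          ring }
    have h2 := congrArg L h
    rw [map_sum] at h2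
    simp only [map_smul, smul_eq_mul] at h2
    exact h2.symm
  rw [hw, connection_eq_sum]
  simp only [map_sum, map_smul, sum_apply, smul_apply, smul_eq_mul]
  refine Finset.sum_congr rfl fun l _ => ?_
  rw [apply_raised (isInvertible_metricInChart g hq), mul_comm]

theorem fderiv_metricInChart_symm (g : Metric E M) {p q : M} (hq : q ∈ (chart E p).source)
    (u v w : E) : fderiv ℝ (metricInChart g p) (chart E p q) u v w =
      fderiv ℝ (metricInChart g p) (chart E p q) u w v := by
  have hd := (differentiableAt_of_smooth (contDiffAt_metricInChart g hq)).hasFDerivAt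
  have h : ∀ a b, HasFDerivAt (fun z => metricInChart g p z a b) _ (chart E p q) := fun a b =>
    (hd.clm_apply (hasFDerivAt_const a _)).clm_apply (hasFDerivAt_const b _)
  have h1 := (h v w).fderiv
  simp only [metricInChart_symm g p _ v w] at h1
  have h2 := congrArg (fun L : E →L[ℝ] ℝ => L u) (h1.symm.trans (h w v).fderiv)
  simpa using h2

/-- The supply of hypotheses for the coordinate computation. The classical identity `Γ_{ij,k} +
Γ_{ik,j} = ∂_i g_{jk}` gives compatibility; it is checked at every point of the chart, hence on a
neighbourhood. -/
theorem isLeviCivitaAt_connection (g : Metric E M) {p q : M} (hq : q ∈ (chart E p).source) :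
    IsLeviCivitaAt (metricInChart g p) (connection g p) (chart E p q) where
  smooth_metric := contDiffAt_metricInChart g hq
  smooth_connection := by
    refine contDiffAt_clm_of_apply fun u => contDiffAt_clm_of_apply fun v => ?_
    simp only [connection_eq_sum]
    have hd := contDiffAt_fderiv (contDiffAt_metricInChart g hq)
    have hd' : ∀ a b c : E, ContDiffAt ℝ ∞
        (fun z => fderiv ℝ (metricInChart g p) z a b c) (chart E p q) := fun a b c =>
      ((hd.clm_apply contDiffAt_const).clm_apply contDiffAt_const).clm_apply contDiffAt_const
    exact ContDiffAt.sum fun l _ => ((((hd' _ _ _).add (hd' _ _ _)).sub (hd' _ _ _)).div_const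
      2).smul (contDiffAt_raised (contDiffAt_metricInChart g hq)
        (isInvertible_metricInChart g hq) l)
  invertible := isInvertible_metricInChart g hq
  metric_symm := metricInChart_symm g p _
  torsion_free := by
    filter_upwards [(isOpen_chart_target p).mem_nhds (chart_mem_target hq)] with x hx u v
    obtain ⟨z, hz, rfl⟩ : ∃ z ∈ (chart E p).source, chart E p z = x :=
      ⟨_, (chart E p).map_target hx, (chart E p).right_inv hx⟩
    simp only [connection_eq_sum, christoffelLower, fderiv_metricInChart_symm g hz _ u v]
    congr! 3
    rw [fderiv_metricInChart_symm g hz u v, fderiv_metricInChart_symm g hz v u]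
    ring
  compat := by
    filter_upwards [(isOpen_chart_target p).mem_nhds (chart_mem_target hq)] with x hx u v w
    obtain ⟨z, hz, rfl⟩ : ∃ z ∈ (chart E p).source, chart E p z = x :=
      ⟨_, (chart E p).map_target hx, (chart E p).right_inv hx⟩
    rw [metricInChart_symm g p _ v, metricInChart_connection g hz, metricInChart_connection g hz]
    simp only [christoffelLower]
    rw [fderiv_metricInChart_symm g hz u w v]
    rw [fderiv_metricInChart_symm g hz v u w]
    ring

/-- The metric coefficients in two charts are related by the transition map. -/
theorem metricInChart_transition (g : Metric E M) {p p' q : M} (hq : q ∈ (chart E p).source)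
    (hq' : q ∈ (chart E p').source) (u v : E) :
    metricInChart g p (chart E p q) u v =
      metricInChart g p' (transition E p p' (chart E p q))
        (fderiv ℝ (transition E p p') (chart E p q) u)
        (fderiv ℝ (transition E p p') (chart E p q) v) := by
  have e : transition E p p' (chart E p q) = chart E p' q := mapRep_chart _ _ hq
  rw [e, metricInChart_chart g hq, metricInChart_chart g hq',
    ← toCoord_ofCoord hq hq', ← toCoord_ofCoord hq hq', ofCoord_toCoord_of_mem hq',
    ofCoord_toCoord_of_mem hq']

/-- The transformation law of the Christoffel symbols. -/
theorem connection_transition (g : Metric E M) {p p' q : M} (hq : q ∈ (chart E p).source)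
    (hq' : q ∈ (chart E p').source) (u v : E) :
    fderiv ℝ (transition E p p') (chart E p q) (connection g p (chart E p q) u v) =
      fderiv ℝ (fderiv ℝ (transition E p p')) (chart E p q) u v +
      connection g p' (transition E p p' (chart E p q))
        (fderiv ℝ (transition E p p') (chart E p q) u)
        (fderiv ℝ (transition E p p') (chart E p q) v) := by
  have hG := isLeviCivitaAt_connection g hq
  have hH := isLeviCivitaAt_connection g hq'
  have e : transition E p p' (chart E p q) = chart E p' q := mapRep_chart _ _ hq
  rw [← e] at hH
  -- The transition map is a local isometry of the coordinate metrics. Its Jacobian is surjective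
  -- because the opposite change of coordinates inverts it.
  refine fderiv_connection_of_isometry (differentiableAt_of_smooth hH.smooth_metric)
    (contDiffAt_transition hq hq') ?_ (differentiableAt_of_smooth hG.smooth_metric) hH.invertible
    hH.metric_symm ?_ hG.torsion_free.self_of_nhds hH.torsion_free.self_of_nhds
    hG.compat.self_of_nhds hH.compat.self_of_nhds u v
  · filter_upwards [(isOpen_chart_target p).mem_nhds (chart_mem_target hq),
      (tendsto_chart_symm hq).eventually (eventually_mem_source hq')] with x hx hx' u v
    have := metricInChart_transition g ((chart E p).map_target hx) hx' u v
    rwa [(chart E p).right_inv hx] at this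
  · intro w
    refine ⟨toCoord p q (ofCoord p' q w), ?_⟩
    rw [← toCoord_ofCoord hq hq', ofCoord_toCoord_of_mem hq, toCoord_ofCoord_of_mem hq']

end MetricInChart

/-! ### Covariant derivatives in arbitrary charts. -/

section Transfer

variable {E : Type*} [NormedAddCommGroup E] [NormedSpace ℝ E] [FiniteDimensional ℝ E]
  {M : Type*} [TopologicalSpace M] [ChartedSpace E M] [IsManifold 𝓘(ℝ, E) ∞ M]
  {F : Type*} [NormedAddCommGroup F] [NormedSpace ℝ F] [FiniteDimensional ℝ F]
  {N : Type*} [TopologicalSpace N] [ChartedSpace F N] [IsManifold 𝓘(ℝ, F) ∞ N]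

/-- The components of a vector field along `φ`, in the charts around `p` and `y`. -/
def fieldRep (E : Type*) [NormedAddCommGroup E] [NormedSpace ℝ E]
    {M : Type*} [TopologicalSpace M] [ChartedSpace E M]
    {φ : M → N} (V : Π q : M, T F (φ q)) (p : M) (y : N) (x : E) : F :=
  toCoord y (φ ((chart E p).symm x)) (V ((chart E p).symm x))

theorem fieldRep_chart {φ : M → N} (V : Π q : M, T F (φ q)) {p q : M} (y : N)
    (hq : q ∈ (chart E p).source) : fieldRep E V p y (chart E p q) = toCoord y (φ q) (V q) := by
  rw [fieldRep, (chart E p).left_inv hq]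

/-- The covariant derivative is natural under changes of coordinates. -/
theorem covDeriv_comp {Γ Γ' : F → F →L[ℝ] F →L[ℝ] F} {ψ : F → F} {f s : E → F} {x : E}
    (hψ : ContDiffAt ℝ ∞ ψ (f x)) (hf : DifferentiableAt ℝ f x) (hs : DifferentiableAt ℝ s x)
    (h : ∀ u v, fderiv ℝ ψ (f x) (Γ (f x) u v) = fderiv ℝ (fderiv ℝ ψ) (f x) u v +
      Γ' (ψ (f x)) (fderiv ℝ ψ (f x) u) (fderiv ℝ ψ (f x) v)) (u : E) :
    covDeriv Γ' (ψ ∘ f) (fun z => fderiv ℝ ψ (f z) (s z)) x u =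
      fderiv ℝ ψ (f x) (covDeriv Γ f s x u) := by
  have h1 : HasFDerivAt (fun z => fderiv ℝ ψ (f z))
      (fderiv ℝ (fderiv ℝ ψ) (f x) ∘L fderiv ℝ f x) x :=
    (differentiableAt_of_smooth (contDiffAt_fderiv hψ)).hasFDerivAt.comp x hf.hasFDerivAt
  rw [covDeriv_apply, covDeriv_apply, map_add, h, (h1.clm_apply hs.hasFDerivAt).fderiv,
    fderiv_comp x (differentiableAt_of_smooth hψ) hf]
  simp
  abel

theorem covDeriv_congr {Γ : F → F →L[ℝ] F →L[ℝ] F} {f f' s s' : E → F} {x : E}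
    (hf : f =ᶠ[nhds x] f') (hs : s =ᶠ[nhds x] s') : covDeriv Γ f s x = covDeriv Γ f' s' x := by
  rw [covDeriv, covDeriv, hf.fderiv_eq, hs.fderiv_eq, hf.eq_of_nhds, hs.eq_of_nhds]

theorem mem_own_chart (p : M) : p ∈ (chart E p).source := mem_extChartAt_source p

theorem toCoord_constField_eventuallyEq {p : M} (v : T E p) :
    (fun q : M => (toCoord p q (constField v q) : E)) =ᶠ[nhds p] fun _ => toCoord p p v := by
  filter_upwards [eventually_mem_source (mem_own_chart (E := E) p)] with q hq
  rw [constField_eq v hq, toCoord_ofCoord_of_mem hq]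

theorem leviCivita_apply (g : Metric E M) (Y : Π q : M, T E q) (p : M) (u : T E p) :
    leviCivita g Y p u = ofCoord p p (mvfderiv 𝓘(ℝ, E) (fun q => toCoord p q (Y q)) p u +
      connection g p (chart E p p) (toCoord p p u) (toCoord p p (Y p))) := rfl

theorem leviCivita_constField (g : Metric E M) {p : M} (v u : T E p) :
    leviCivita g (constField v) p u = ofCoord p p
      (connection g p (chart E p p) (toCoord p p u) (toCoord p p v)) := by
  have h : mvfderiv 𝓘(ℝ, E) (fun q => toCoord p q (constField v q)) p = 0 := by
    have h1 : mfderiv 𝓘(ℝ, E) 𝓘(ℝ, E) (fun q => toCoord p q (constField v q)) p = _ :=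
      (toCoord_constField_eventuallyEq v).mfderiv_eq
    have h2 : mvfderiv 𝓘(ℝ, E) (fun q => toCoord p q (constField v q)) p =
      mvfderiv 𝓘(ℝ, E) (fun _ : M => toCoord p p v) p := h1
    rw [h2, mvfderiv_const]
  have h3 : constField v p = v := FiberBundle.extend_apply_self E v
  rw [leviCivita_apply, h, h3, zero_apply, zero_add]

/-- The field `constField (V q)` has constant components, so its Levi-Civita derivative is only the
Christoffel term. -/
theorem covAlong_own_chart (h : Metric F N) {φ : M → N}
    (V : Π q : M, T F (φ q)) (q : M) (u : T E q) :
    covAlong E h φ V q u = ofCoord (φ q) (φ q)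
      (mvfderiv 𝓘(ℝ, E) (fun z => toCoord (φ q) (φ z) (V z)) q u +
      connection h (φ q) (chart F (φ q) (φ q)) (toCoord (φ q) (φ q) (diff E F φ q u))
        (toCoord (φ q) (φ q) (V q))) := by
  have h1 := leviCivita_constField h (V q) (diff E F φ q u)
  rw [map_add, ← h1]
  rfl

/-- The coordinate expression of the covariant derivative along `φ`, in any charts. -/
theorem covAlong_ofCoord (h : Metric F N) {φ : M → N}
    (hφ : ContMDiff 𝓘(ℝ, E) 𝓘(ℝ, F) ∞ φ) (V : Π q : M, T F (φ q)) {p q : M} {y : N}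
    (hq : q ∈ (chart E p).source) (hy : φ q ∈ (chart F y).source)
    (hV : DifferentiableAt ℝ (fieldRep E V p y) (chart E p q)) (u : E) :
    covAlong E h φ V q (ofCoord p q u) = ofCoord y (φ q)
      (covDeriv (connection h y) (mapRep E F φ p y) (fieldRep E V p y) (chart E p q) u) := by
  set x := chart E p q with hx
  have hf := contDiffAt_mapRep hφ hq hy
  have hfx : mapRep E F φ p y x = chart F y (φ q) := mapRep_chart φ y hq
  have hy' := mem_own_chart (E := F) (φ q)
  have hφc : ∀ᶠ z in nhds x, φ ((chart E p).symm z) ∈ (chart F y).source ∧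
      φ ((chart E p).symm z) ∈ (chart F (φ q)).source :=
    (hφ.continuous.continuousAt.tendsto.comp (tendsto_chart_symm hq)).eventually
      ((eventually_mem_source hy).and (eventually_mem_source hy'))
  have hψ : ContDiffAt ℝ ∞ (transition F y (φ q)) (mapRep E F φ p y x) := by
    rw [hfx]; exact contDiffAt_transition hy hy'
  have e1 : mapRep E F φ p (φ q) =ᶠ[nhds x] transition F y (φ q) ∘ mapRep E F φ p y := by
    filter_upwards [hφc] with z hz
    exact (mapRep_chart id (φ q) hz.1).symm
  have e2 : fieldRep E V p (φ q) =ᶠ[nhds x]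
      fun z => fderiv ℝ (transition F y (φ q)) (mapRep E F φ p y z) (fieldRep E V p y z) := by
    filter_upwards [hφc] with z hz
    have := toCoord_ofCoord hz.1 hz.2 (fieldRep E V p y z)
    rw [fieldRep, ofCoord_toCoord_of_mem hz.1] at this
    exact this
  have hV' : DifferentiableAt ℝ (fieldRep E V p (φ q)) x := by
    refine DifferentiableAt.congr_of_eventuallyEq ?_ e2
    exact ((differentiableAt_of_smooth (contDiffAt_fderiv hψ)).comp x
      (differentiableAt_of_smooth hf)).clm_apply hV
  -- The definition uses the chart around `φ q`, while `y` is fixed. The two are matched by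
  -- naturality of the covariant derivative under the transition map.
  have h3 := covDeriv_comp hψ (differentiableAt_of_smooth hf) hV
    (by rw [hfx]; exact connection_transition h hy hy') u
  rw [← covDeriv_congr e1 e2, hfx, ← toCoord_ofCoord hy hy'] at h3
  have h4 := congrArg (ofCoord (φ q) (φ q)) h3
  rw [ofCoord_toCoord_of_mem hy'] at h4
  rw [← h4, covAlong_own_chart, mvfderiv_ofCoord hq ((mdifferentiableAt_iff_chart hq).mpr hV'),
    toCoord_diff hφ hq hy', covDeriv_apply, mapRep_chart φ _ hq, fieldRep_chart V _ hq]
  rfl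

/-- Viewing `∇` on `M` as the connection along the identity lets it inherit chart independence from
the case of a general map. -/
theorem leviCivita_eq_covAlong (g : Metric E M) (Y : Π q : M, T E q) (q : M) (u : T E q) :
    leviCivita g Y q u = covAlong E g id Y q u := by
  rw [covAlong_own_chart, leviCivita_apply, diff, mfderiv_id]
  rfl

/-- The coordinate expression of the Levi-Civita connection, in any chart. -/
theorem leviCivita_ofCoord (g : Metric E M) (Y : Π q : M, T E q) {p q : M}
    (hq : q ∈ (chart E p).source)
    (hY : DifferentiableAt ℝ (fieldRep E (φ := id) Y p p) (chart E p q)) (u : E) :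
    leviCivita g Y q (ofCoord p q u) = ofCoord p q
      (fderiv ℝ (fieldRep E (φ := id) Y p p) (chart E p q) u +
        connection g p (chart E p q) u (toCoord p q (Y q))) := by
  rw [leviCivita_eq_covAlong, covAlong_ofCoord g contMDiff_id Y hq hq hY, covDeriv_apply,
    (mapRep_self_eventuallyEq hq).fderiv_eq, fderiv_id, fieldRep_chart _ _ hq,
    mapRep_chart id p hq]
  rfl

end Transfer

/-! ### Second fundamental form, tension field, Laplacian and curvature in coordinates. -/

section Tension

variable {E : Type*} [NormedAddCommGroup E] [NormedSpace ℝ E] [FiniteDimensional ℝ E]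
  {M : Type*} [TopologicalSpace M] [ChartedSpace E M] [IsManifold 𝓘(ℝ, E) ∞ M]
  {F : Type*} [NormedAddCommGroup F] [NormedSpace ℝ F] [FiniteDimensional ℝ F]
  {N : Type*} [TopologicalSpace N] [ChartedSpace F N] [IsManifold 𝓘(ℝ, F) ∞ N]

theorem eventually_nhds_chart {p q : M} (hq : q ∈ (chart E p).source) {P : E → Prop}
    (h : ∀ᶠ z in nhds q, P (chart E p z)) : ∀ᶠ x in nhds (chart E p q), P x := by
  filter_upwards [(isOpen_chart_target p).mem_nhds (chart_mem_target hq),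
    (tendsto_chart_symm hq).eventually h] with x hx hx'
  rwa [(chart E p).right_inv hx] at hx'

theorem eventually_mem_charts {φ : M → N} (hφ : ContMDiff 𝓘(ℝ, E) 𝓘(ℝ, F) ∞ φ) {p q : M} {y : N}
    (hq : q ∈ (chart E p).source) (hy : φ q ∈ (chart F y).source) :
    ∀ᶠ z in nhds q, z ∈ (chart E p).source ∧ φ z ∈ (chart F y).source :=
  (eventually_mem_source hq).and
    (hφ.continuous.continuousAt.tendsto.eventually (eventually_mem_source hy))

theorem constField_self {p : M} (v : T E p) : constField v p = v :=
  FiberBundle.extend_apply_self E v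

/-- Constant fields of one chart are smooth in any other. -/
theorem contDiffAt_fieldRep_constField {p q : M} (hq : q ∈ (chart E p).source) (v : T E q) :
    ContDiffAt ℝ ∞ (fieldRep E (φ := id) (constField v) p p) (chart E p q) := by
  have hq' := mem_own_chart (E := E) q
  have e : transition E p q (chart E p q) = chart E q q := mapRep_chart _ _ hq
  have h1 : ContDiffAt ℝ ∞ (fun z => fderiv ℝ (transition E q p) (transition E p q z)
      (toCoord q q v)) (chart E p q) := by
    refine ContDiffAt.clm_apply ?_ contDiffAt_const
    refine ContDiffAt.comp (chart E p q) ?_ (contDiffAt_transition hq hq')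
    rw [e]
    exact contDiffAt_fderiv (contDiffAt_transition hq' hq)
  refine h1.congr_of_eventuallyEq (eventually_nhds_chart hq ?_)
  filter_upwards [eventually_mem_source hq, eventually_mem_source hq'] with z hz hz'
  have e' : transition E p q (chart E p z) = chart E q z := mapRep_chart _ _ hz
  rw [fieldRep_chart _ _ hz, e', ← toCoord_ofCoord hz' hz, constField_eq v hz']
  rfl

theorem fieldRep_diff {φ : M → N} (hφ : ContMDiff 𝓘(ℝ, E) 𝓘(ℝ, F) ∞ φ) {p q : M} {y : N}
    (hq : q ∈ (chart E p).source) (hy : φ q ∈ (chart F y).source) (W : Π q : M, T E q) :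
    fieldRep E (fun z => diff E F φ z (W z)) p y =ᶠ[nhds (chart E p q)]
      fun x => fderiv ℝ (mapRep E F φ p y) x (fieldRep E (φ := id) W p p x) := by
  refine eventually_nhds_chart hq ?_
  filter_upwards [eventually_mem_charts hφ hq hy] with z hz
  have h1 : fieldRep E (φ := id) W p p (chart E p z) = toCoord p z (W z) := fieldRep_chart _ _ hz.1
  rw [fieldRep_chart _ _ hz.1, h1, ← toCoord_diff hφ hz.1 hz.2, ofCoord_toCoord_of_mem hz.1]

/-- The extension of the second vector is constant in the chart around `q`, not in the chart around
`p`. The derivative of its components occurs in both terms of the definition and cancels: this is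
the tensoriality of `∇dφ`. -/
theorem hessian_ofCoord (g : Metric E M) (h : Metric F N) {φ : M → N}
    (hφ : ContMDiff 𝓘(ℝ, E) 𝓘(ℝ, F) ∞ φ) {p q : M} {y : N}
    (hq : q ∈ (chart E p).source) (hy : φ q ∈ (chart F y).source) (u w : E) :
    hessian g h φ q (ofCoord p q u) (ofCoord p q w) = ofCoord y (φ q)
      (secondFF (connection g p) (connection h y) (mapRep E F φ p y) (chart E p q) u w) := by
  have hW := differentiableAt_of_smooth (contDiffAt_fieldRep_constField hq (ofCoord p q w))
  have hWq : fieldRep E (φ := id) (constField (ofCoord p q w)) p p (chart E p q) = w := by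
    rw [fieldRep_chart _ _ hq, constField_self]
    exact toCoord_ofCoord_of_mem hq w
  have hf := differentiableAt_of_smooth (contDiffAt_fderiv (contDiffAt_mapRep hφ hq hy))
  have e := fieldRep_diff hφ hq hy (constField (ofCoord p q w))
  have hd := hf.hasFDerivAt.clm_apply hW.hasFDerivAt
  rw [hessian, covAlong_ofCoord h hφ _ hq hy (hd.differentiableAt.congr_of_eventuallyEq e),
    leviCivita_ofCoord g _ hq hW, diff_ofCoord hφ hq hy, ← map_sub, constField_self,
    toCoord_ofCoord_of_mem hq, covDeriv_congr Filter.EventuallyEq.rfl e, covDeriv_apply, hd.fderiv,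
    secondFF_apply, hWq]
  congr 1
  simp
  abel

/-- The pairing of the basis with its dual basis does not depend on the basis. -/
theorem sum_basis_coord {W V ι κ : Type*} [AddCommGroup W] [Module ℝ W] [AddCommGroup V]
    [Module ℝ V] [Fintype ι] [Fintype κ] (C : W →ₗ[ℝ] (W →ₗ[ℝ] ℝ) →ₗ[ℝ] V)
    (b : Module.Basis ι ℝ W) (b' : Module.Basis κ ℝ W) :
    ∑ i, C (b i) (b.coord i) = ∑ j, C (b' j) (b'.coord j) := by
  have h1 : ∀ i, b.coord i = ∑ j, b.repr (b' j) i • b'.coord j := by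
    intro i
    refine b'.ext fun j => ?_
    simp only [Module.Basis.coord_apply, LinearMap.sum_apply, LinearMap.smul_apply, smul_eq_mul,
      Module.Basis.repr_self]
    rw [Finset.sum_eq_single j (fun k _ hk => by rw [Finsupp.single_eq_of_ne hk, mul_zero])
      (fun hj => absurd (Finset.mem_univ j) hj), Finsupp.single_eq_same, mul_one]
  have h2 : ∀ j, b' j = ∑ i, b.repr (b' j) i • b i := fun j => (b.sum_repr (b' j)).symm
  simp_rw [h1, map_sum, map_smul]
  rw [Finset.sum_comm]
  refine Finset.sum_congr rfl fun j _ => ?_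
  have h3 := congrArg (fun z => C z (b'.coord j)) (h2 j)
  simp only [map_sum, map_smul, LinearMap.sum_apply, LinearMap.smul_apply] at h3
  exact h3.symm

theorem toCoord_sharp (g : Metric E M) {p q : M} (hq : q ∈ (chart E p).source)
    (α : T E q →L[ℝ] ℝ) : toCoord p q (sharp g q α) =
      (metricInChart g p (chart E p q)).inverse (α ∘L ofCoord p q) := by
  have hi := isInvertible_metricInChart g hq
  refine eq_of_apply_eq hi fun v => ?_
  rw [hi.self_apply_inverse, metricInChart_chart g hq, ofCoord_toCoord_of_mem hq, inner_sharp]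
  rfl

/-- The trace in coordinates. -/
theorem traceAt_eq_trace (g : Metric E M) {p q : M} (hq : q ∈ (chart E p).source)
    {V V' : Type*} [AddCommGroup V] [Module ℝ V] [AddCommGroup V'] [Module ℝ V']
    (B : T E q → T E q → V') (A : E →ₗ[ℝ] E →ₗ[ℝ] V) (l : V →ₗ[ℝ] V')
    (hB : ∀ u w, B (ofCoord p q u) (ofCoord p q w) = l (A u w)) :
    traceAt g q B = l (trace (metricInChart g p (chart E p q)) fun u w => A u w) := by
  let e : T E q ≃ₗ[ℝ] E :=
    { (toCoord p q).toLinearMap with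
      invFun := ofCoord p q
      left_inv := ofCoord_toCoord_of_mem hq
      right_inv := toCoord_ofCoord_of_mem hq }
  let b := Module.finBasis ℝ (T E q)
  let C : E →ₗ[ℝ] (E →ₗ[ℝ] ℝ) →ₗ[ℝ] V :=
    A.compl₂ (((metricInChart g p (chart E p q)).inverse : (E →L[ℝ] ℝ) →ₗ[ℝ] E) ∘ₗ
      (LinearMap.toContinuousLinearMap : (E →ₗ[ℝ] ℝ) ≃ₗ[ℝ] (E →L[ℝ] ℝ)).toLinearMap)
  -- The bases chosen in `T_q M` and in `E` are unrelated, so the first is carried over by `toCoord`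
  -- and then exchanged for the second.
  have h := sum_basis_coord C (b.map e) (Module.finBasis ℝ E)
  have hR : trace (metricInChart g p (chart E p q)) (fun u w => A u w) =
      ∑ j, C (Module.finBasis ℝ E j) ((Module.finBasis ℝ E).coord j) := rfl
  rw [hR, ← h, map_sum]
  refine Finset.sum_congr rfl fun i _ => ?_
  have h1 := hB (toCoord p q (b i)) (toCoord p q (sharp g q
    (LinearMap.toContinuousLinearMap (b.coord i))))
  rw [ofCoord_toCoord_of_mem hq, ofCoord_toCoord_of_mem hq, toCoord_sharp g hq] at h1
  exact h1

/-- A continuous bilinear map as a bilinear map. -/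
def bilin {V : Type*} [NormedAddCommGroup V] [NormedSpace ℝ V] (B : E →L[ℝ] E →L[ℝ] V) :
    E →ₗ[ℝ] E →ₗ[ℝ] V :=
  LinearMap.mk₂ ℝ (fun u v => B u v) (by simp) (by simp) (by simp) (by simp)

/-- The tension field in coordinates. -/
def tensionRep (G : E → E →L[ℝ] E →L[ℝ] ℝ) (Γ : E → E →L[ℝ] E →L[ℝ] E)
    (Γ' : F → F →L[ℝ] F →L[ℝ] F) (f : E → F) (x : E) : F :=
  trace (G x) fun u w => secondFF Γ Γ' f x u w

theorem tension_eq (g : Metric E M) (h : Metric F N) {φ : M → N}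
    (hφ : ContMDiff 𝓘(ℝ, E) 𝓘(ℝ, F) ∞ φ) {p q : M} {y : N}
    (hq : q ∈ (chart E p).source) (hy : φ q ∈ (chart F y).source) :
    tension g h φ q = ofCoord y (φ q) (tensionRep (metricInChart g p) (connection g p)
      (connection h y) (mapRep E F φ p y) (chart E p q)) :=
  traceAt_eq_trace g hq (hessian g h φ q) (bilin (secondFF (connection g p) (connection h y)
    (mapRep E F φ p y) (chart E p q))) (ofCoord y (φ q)).toLinearMap fun u w => hessian_ofCoord g h hφ hq hy u w

theorem fieldRep_tension (g : Metric E M) (h : Metric F N) {φ : M → N}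
    (hφ : ContMDiff 𝓘(ℝ, E) 𝓘(ℝ, F) ∞ φ) {p q : M} {y : N}
    (hq : q ∈ (chart E p).source) (hy : φ q ∈ (chart F y).source) :
    fieldRep E (tension g h φ) p y =ᶠ[nhds (chart E p q)] tensionRep (metricInChart g p)
      (connection g p) (connection h y) (mapRep E F φ p y) := by
  refine eventually_nhds_chart hq ?_
  filter_upwards [eventually_mem_charts hφ hq hy] with z hz
  rw [fieldRep_chart _ _ hz.1, tension_eq g h hφ hz.1 hz.2, toCoord_ofCoord_of_mem hz.2]

theorem isLeviCivitaAt_mapRep (h : Metric F N) (φ : M → N) {p q : M} {y : N}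
    (hq : q ∈ (chart E p).source) (hy : φ q ∈ (chart F y).source) :
    IsLeviCivitaAt (metricInChart h y) (connection h y) (mapRep E F φ p y (chart E p q)) := by
  rw [mapRep_chart _ _ hq]
  exact isLeviCivitaAt_connection h hy

/-- Provides the derivatives of `τ` that the Euler-Lagrange equation and the divergence involve:
near the point a single smooth coordinate expression represents the tension field. -/
theorem contDiffAt_fieldRep_tension (g : Metric E M) (h : Metric F N) {φ : M → N}
    (hφ : ContMDiff 𝓘(ℝ, E) 𝓘(ℝ, F) ∞ φ) {p q : M} {y : N}
    (hq : q ∈ (chart E p).source) (hy : φ q ∈ (chart F y).source) :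
    ContDiffAt ℝ ∞ (fieldRep E (tension g h φ) p y) (chart E p q) := by
  have hG := isLeviCivitaAt_connection g hq
  refine ContDiffAt.congr_of_eventuallyEq ?_ (fieldRep_tension g h hφ hq hy)
  exact contDiffAt_trace hG.smooth_metric hG.invertible (contDiffAt_secondFF hG.smooth_connection
    (isLeviCivitaAt_mapRep h φ hq hy).smooth_connection (contDiffAt_mapRep hφ hq hy))

/-! ### The Laplacian and the curvature in coordinates -/

/-- In the chart around `p` the extension of the second vector is constant, so the inner derivative
is `covDeriv` applied to a fixed vector. Its formula is needed throughout a neighbourhood before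
differentiating again, hence the hypothesis near `p`. -/
theorem laplacian_eq (g : Metric E M) (h : Metric F N) {φ : M → N}
    (hφ : ContMDiff 𝓘(ℝ, E) 𝓘(ℝ, F) ∞ φ) (V : Π q : M, T F (φ q)) (p : M)
    (hV : ∀ᶠ q in nhds p, ContDiffAt ℝ ∞ (fieldRep E V p (φ p)) (chart E p q)) :
    laplacian g h φ V p = ofCoord (φ p) (φ p) (trace (metricInChart g p (chart E p p))
      fun u w => covDeriv₂ (connection g p) (connection h (φ p)) (mapRep E F φ p (φ p))
        (fieldRep E V p (φ p)) (chart E p p) u w) := by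
  have hp := mem_own_chart (E := E) p
  have hy := mem_own_chart (E := F) (φ p)
  have hH := isLeviCivitaAt_mapRep h φ hp hy
  have hf := contDiffAt_mapRep hφ hp hy
  have hc := differentiableAt_of_smooth
    (contDiffAt_covDeriv hH.smooth_connection hf hV.self_of_nhds)
  refine traceAt_eq_trace g hp _ (bilin (covDeriv₂ (connection g p) (connection h (φ p))
    (mapRep E F φ p (φ p)) (fieldRep E V p (φ p)) (chart E p p))) (ofCoord (φ p) (φ p)).toLinearMap
    fun u w => ?_
  have e : fieldRep E (fun q => covAlong E h φ V q (constField (ofCoord p p w : T E p) q)) p (φ p)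
      =ᶠ[nhds (chart E p p)] fun x => covDeriv (connection h (φ p)) (mapRep E F φ p (φ p))
        (fieldRep E V p (φ p)) x w := by
    refine eventually_nhds_chart hp ?_
    filter_upwards [eventually_mem_charts hφ hp hy, hV] with z hz hVz
    rw [fieldRep_chart _ _ hz.1, constField_eq _ hz.1, toCoord_ofCoord_of_mem hp,
      covAlong_ofCoord h hφ V hz.1 hz.2 (differentiableAt_of_smooth hVz),
      toCoord_ofCoord_of_mem hz.2]
  have hd : DifferentiableAt ℝ (fun x => covDeriv (connection h (φ p)) (mapRep E F φ p (φ p))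
        (fieldRep E V p (φ p)) x w) (chart E p p) :=
    hc.clm_apply (differentiableAt_const w)
  rw [covAlong_ofCoord h hφ _ hp hy (hd.congr_of_eventuallyEq e),
    covDeriv_congr Filter.EventuallyEq.rfl e, leviCivita_constField, toCoord_ofCoord_of_mem hp,
    toCoord_ofCoord_of_mem hp, covAlong_ofCoord h hφ V hp hy
      (differentiableAt_of_smooth hV.self_of_nhds), ← map_sub, ← covDeriv₂_apply hc]
  rfl

/-- Pulled back through the inverse chart both fields are constant, and constant fields commute. -/
theorem mlieBracket_constField (y : N) (u v : T F y) :
    VectorField.mlieBracket 𝓘(ℝ, F) (constField u) (constField v) y = 0 := by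
  have hy := mem_own_chart (E := F) y
  have key : ∀ u : T F y, VectorField.mpullbackWithin 𝓘(ℝ, F) 𝓘(ℝ, F) (chart F y).symm
      (constField u) (Set.range 𝓘(ℝ, F)) =ᶠ[nhds (chart F y y)]
        (fun _ => (toCoord y y u : F) : F → F) := by
    intro u
    filter_upwards [(isOpen_chart_target y).mem_nhds (chart_mem_target hy)] with x hx
    have hz := (chart F y).map_target hx
    have h1 := mfderiv_extChartAt_comp_mfderivWithin_extChartAt_symm (I := 𝓘(ℝ, F)) hx
    rw [← toCoord_eq_mfderiv hz] at h1
    refine (isInvertible_mfderivWithin_extChartAt_symm hx).inverse_apply_eq.mpr ?_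
    rw [constField_eq u hz]
    have h2 := congrArg (fun L : F →L[ℝ] F => L (toCoord y y u)) h1
    have h3 := congrArg (ofCoord y ((chart F y).symm x)) h2
    exact (h3.symm.trans (ofCoord_toCoord_of_mem hz _))
  have h0 : ∀ s : Set F, VectorField.lieBracketWithin ℝ (VectorField.mpullbackWithin 𝓘(ℝ, F)
      𝓘(ℝ, F) (chart F y).symm (constField u) (Set.range 𝓘(ℝ, F)))
      (VectorField.mpullbackWithin 𝓘(ℝ, F) 𝓘(ℝ, F) (chart F y).symm (constField v)
        (Set.range 𝓘(ℝ, F))) s (chart F y y) = 0 := by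
    intro s
    rw [(key u).lieBracketWithin_vectorField_eq_nhds (key v), VectorField.lieBracketWithin_eq]
    simp
  rw [← VectorField.mlieBracketWithin_univ, VectorField.mlieBracketWithin_apply]
  refine Eq.trans (congrArg _ (h0 _)) ?_
  exact map_zero _

/-- For fields constant in the chart around `y`, the inner derivative is `Γ(v, w)` at all nearby
points; differentiating it gives `∂Γ + ΓΓ`. The bracket term drops out because coordinate fields
commute. -/
theorem curvature_ofCoord (h : Metric F N) (y : N) (u v w : F) :
    curvature h y (ofCoord y y u) (ofCoord y y v) (ofCoord y y w) =
      ofCoord y y (curv (connection h y) (chart F y y) u v w) := by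
  have hy := mem_own_chart (E := F) y
  have hΓ := differentiableAt_of_smooth (isLeviCivitaAt_connection h hy).smooth_connection
  have key : ∀ u v, leviCivita h (fun z => leviCivita h (constField (ofCoord y y w : T F y)) z
      (constField (ofCoord y y v : T F y) z)) y (ofCoord y y u) =
      ofCoord y y (fderiv ℝ (connection h y) (chart F y y) u v w +
        connection h y (chart F y y) u (connection h y (chart F y y) v w)) := by
    intro u v
    have e : fieldRep F (φ := id) (fun z => leviCivita h (constField (ofCoord y y w : T F y)) z
      (constField (ofCoord y y v : T F y) z)) y y =ᶠ[nhds (chart F y y)]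
        fun x => connection h y x v w := by
      have hw : fieldRep F (φ := id) (constField (ofCoord y y w : T F y)) y y
          =ᶠ[nhds (chart F y y)] fun _ => w := by
        refine eventually_nhds_chart hy ?_
        filter_upwards [eventually_mem_source hy] with z hz
        rw [fieldRep_chart _ _ hz, constField_eq _ hz, toCoord_ofCoord_of_mem hy]
        exact toCoord_ofCoord_of_mem hz w
      refine eventually_nhds_chart hy ?_
      filter_upwards [eventually_mem_source hy,
        (tendsto_chart hy).eventually hw.eventuallyEq_nhds] with z hz hwz
      have hwd : DifferentiableAt ℝ (fieldRep F (φ := id) (constField (ofCoord y y w : T F y)) y y)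
        (chart F y z) := (differentiableAt_const w).congr_of_eventuallyEq hwz
      rw [fieldRep_chart _ _ hz, constField_eq _ hz, toCoord_ofCoord_of_mem hy]
      have h1 := leviCivita_ofCoord h (constField (ofCoord y y w : T F y)) hz hwd v
      rw [h1, hwz.fderiv_eq, fderiv_fun_const, constField_eq _ hz, toCoord_ofCoord_of_mem hy,
        toCoord_ofCoord_of_mem hz]
      refine (toCoord_ofCoord_of_mem hz _).trans ?_
      simp
    have hd := (hΓ.hasFDerivAt.clm_apply (hasFDerivAt_const v _)).clm_apply (hasFDerivAt_const w _)
    rw [leviCivita_ofCoord h _ hy (hd.differentiableAt.congr_of_eventuallyEq e), e.fderiv_eq,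
      hd.fderiv]
    have e2 := e.eq_of_nhds
    rw [fieldRep_chart _ _ hy] at e2
    have e3 : toCoord y y (leviCivita h (constField (ofCoord y y w : T F y)) y
      (constField (ofCoord y y v : T F y) y)) = connection h y (chart F y y) v w := e2
    rw [e3]
    congr 1
    simp
  rw [curvature, key, key, mlieBracket_constField, map_zero, sub_zero, ← map_sub, curv]

end Tension

/-! ### The energy-momentum tensor in coordinates and the conclusion. -/

section EnergyMomentum

variable {E : Type*} [NormedAddCommGroup E] [NormedSpace ℝ E] [FiniteDimensional ℝ E]
  {M : Type*} [TopologicalSpace M] [ChartedSpace E M] [IsManifold 𝓘(ℝ, E) ∞ M]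
  {F : Type*} [NormedAddCommGroup F] [NormedSpace ℝ F] [FiniteDimensional ℝ F]
  {N : Type*} [TopologicalSpace N] [ChartedSpace F N] [IsManifold 𝓘(ℝ, F) ∞ N]

theorem inner_ofCoord (h : Metric F N) (φ : M → N) {p q : M} {y : N}
    (hq : q ∈ (chart E p).source) (hy : φ q ∈ (chart F y).source) (u v : F) :
    h.inner (φ q) (ofCoord y (φ q) u) (ofCoord y (φ q) v) =
      metricInChart h y (mapRep E F φ p y (chart E p q)) u v := by
  rw [mapRep_chart _ _ hq, metricInChart_chart h hy]

theorem energyMomentum_ofCoord (g : Metric E M) (h : Metric F N) {φ : M → N}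
    (hφ : ContMDiff 𝓘(ℝ, E) 𝓘(ℝ, F) ∞ φ) (δ₁ δ₂ : ℝ) {p q : M} {y : N}
    (hq : q ∈ (chart E p).source) (hy : φ q ∈ (chart F y).source) (v w : E) :
    energyMomentum g h δ₁ δ₂ φ q (ofCoord p q v) (ofCoord p q w) =
      stress (metricInChart g p) (metricInChart h y) (connection h y) (mapRep E F φ p y)
        (fieldRep E (tension g h φ) p y) δ₁ δ₂ (chart E p q) v w := by
  have hV := differentiableAt_of_smooth (contDiffAt_fieldRep_tension g h hφ hq hy)
  have e1 : normSqD g h φ q = _ :=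
    traceAt_eq_trace g hq (fun u w => h.inner (φ q) (diff E F φ q u) (diff E F φ q w))
      (bilin (pairing (metricInChart h y) (mapRep E F φ p y) (fderiv ℝ (mapRep E F φ p y))
        (fderiv ℝ (mapRep E F φ p y)) (chart E p q))) LinearMap.id fun u w => by
        rw [diff_ofCoord hφ hq hy, diff_ofCoord hφ hq hy, inner_ofCoord h φ hq hy]
        rfl
  have e2 : innerDCov g h φ (tension g h φ) q = _ :=
    traceAt_eq_trace g hq (fun u w => h.inner (φ q) (diff E F φ q u)
      (covAlong E h φ (tension g h φ) q w))
      (bilin (pairing (metricInChart h y) (mapRep E F φ p y) (fderiv ℝ (mapRep E F φ p y))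
        (covDeriv (connection h y) (mapRep E F φ p y) (fieldRep E (tension g h φ) p y))
          (chart E p q))) LinearMap.id fun u w => by
        rw [diff_ofCoord hφ hq hy, covAlong_ofCoord h hφ _ hq hy hV, inner_ofCoord h φ hq hy]
        rfl
  have e3 : tension g h φ q =
      ofCoord y (φ q) (fieldRep E (tension g h φ) p y (chart E p q)) := by
    rw [fieldRep_chart _ _ hq, ofCoord_toCoord_of_mem hy]
  have e4 : h.inner (φ q) (tension g h φ q) (tension g h φ q) =
      metricInChart h y (mapRep E F φ p y (chart E p q))
        (fieldRep E (tension g h φ) p y (chart E p q))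
        (fieldRep E (tension g h φ) p y (chart E p q)) := by
    rw [e3, inner_ofCoord h φ hq hy]
  simp only [energyMomentum, LinearMap.mk₂_apply]
  rw [e1, e2, e4, diff_ofCoord hφ hq hy, diff_ofCoord hφ hq hy,
    covAlong_ofCoord h hφ _ hq hy hV, covAlong_ofCoord h hφ _ hq hy hV, inner_ofCoord h φ hq hy,
    inner_ofCoord h φ hq hy, inner_ofCoord h φ hq hy, ← metricInChart_chart g hq]
  rfl

theorem energyMomentum_constField (g : Metric E M) (h : Metric F N) {φ : M → N}
    (hφ : ContMDiff 𝓘(ℝ, E) 𝓘(ℝ, F) ∞ φ) (δ₁ δ₂ : ℝ) (p : M) (v w : E) :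
    (fun x => energyMomentum g h δ₁ δ₂ φ ((chart E p).symm x)
      (constField (ofCoord p p v : T E p) ((chart E p).symm x))
      (constField (ofCoord p p w : T E p) ((chart E p).symm x))) =ᶠ[nhds (chart E p p)]
    fun x => stress (metricInChart g p) (metricInChart h (φ p)) (connection h (φ p))
      (mapRep E F φ p (φ p)) (fieldRep E (tension g h φ) p (φ p)) δ₁ δ₂ x v w := by
  have hp := mem_own_chart (E := E) p
  refine eventually_nhds_chart hp ?_
  filter_upwards [eventually_mem_charts hφ hp (mem_own_chart (E := F) (φ p))] with z hz
  rw [(chart E p).left_inv hz.1, constField_eq _ hz.1, constField_eq _ hz.1,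
    toCoord_ofCoord_of_mem hp, toCoord_ofCoord_of_mem hp, energyMomentum_ofCoord g h hφ _ _ hz.1 hz.2]

theorem curvature_trace_eq (g : Metric E M) (h : Metric F N) {φ : M → N}
    (hφ : ContMDiff 𝓘(ℝ, E) 𝓘(ℝ, F) ∞ φ) (p : M) (a : F) :
    traceAt g p (fun u w => curvature h (φ p) (diff E F φ p u) (ofCoord (φ p) (φ p) a)
      (diff E F φ p w)) = ofCoord (φ p) (φ p) (trace (metricInChart g p (chart E p p))
        fun u w => curv (connection h (φ p)) (mapRep E F φ p (φ p) (chart E p p))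
          (fderiv ℝ (mapRep E F φ p (φ p)) (chart E p p) u) a
          (fderiv ℝ (mapRep E F φ p (φ p)) (chart E p p) w)) := by
  have hp := mem_own_chart (E := E) p
  have hy := mem_own_chart (E := F) (φ p)
  refine traceAt_eq_trace g hp _ (LinearMap.mk₂ ℝ (fun u w => curv (connection h (φ p))
    (mapRep E F φ p (φ p) (chart E p p)) (fderiv ℝ (mapRep E F φ p (φ p)) (chart E p p) u) a
    (fderiv ℝ (mapRep E F φ p (φ p)) (chart E p p) w)) ?_ ?_ ?_ ?_)
    (ofCoord (φ p) (φ p)).toLinearMap fun u w => ?_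
  · intros; simp only [curv, map_add, add_apply]; abel
  · intros; simp only [curv, map_smul, smul_apply, smul_add, smul_sub]
  · intros; simp only [curv, map_add]; abel
  · intros; simp only [curv, map_smul, smul_add, smul_sub]
  · rw [diff_ofCoord hφ hp hy, diff_ofCoord hφ hp hy, curvature_ofCoord, ← mapRep_chart φ _ hp]
    rfl

/-- The Euler-Lagrange equation in coordinates. -/
theorem IsSemiBiharmonic.eq_in_chart {g : Metric E M} {h : Metric F N} {δ₁ δ₂ : ℝ} {φ : M → N}
    (hsemi : IsSemiBiharmonic g h δ₁ δ₂ φ) (hφ : ContMDiff 𝓘(ℝ, E) 𝓘(ℝ, F) ∞ φ) (p : M) :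
    δ₂ • trace (metricInChart g p (chart E p p)) (fun u v => covDeriv₂ (connection g p)
        (connection h (φ p)) (mapRep E F φ p (φ p)) (fieldRep E (tension g h φ) p (φ p))
        (chart E p p) u v) =
      δ₂ • trace (metricInChart g p (chart E p p)) (fun u v => curv (connection h (φ p))
        (mapRep E F φ p (φ p) (chart E p p)) (fderiv ℝ (mapRep E F φ p (φ p)) (chart E p p) u)
        (fieldRep E (tension g h φ) p (φ p) (chart E p p))
        (fderiv ℝ (mapRep E F φ p (φ p)) (chart E p p) v)) +
      δ₁ • fieldRep E (tension g h φ) p (φ p) (chart E p p) := by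
  have hp := mem_own_chart (E := E) p
  have hy := mem_own_chart (E := F) (φ p)
  have h1 := hsemi p
  have e3 : tension g h φ p =
      ofCoord (φ p) (φ p) (fieldRep E (tension g h φ) p (φ p) (chart E p p)) := by
    rw [fieldRep_chart _ _ hp, ofCoord_toCoord_of_mem hy]
  rw [laplacian_eq g h hφ _ p ((eventually_mem_charts hφ hp hy).mono fun z hz =>
    contDiffAt_fieldRep_tension g h hφ hz.1 hz.2)] at h1
  have h2 := curvature_trace_eq g h hφ p (fieldRep E (tension g h φ) p (φ p) (chart E p p))
  rw [← e3] at h2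
  rw [h2, e3, ← map_smul, ← map_smul, ← map_smul, ← map_add] at h1
  have h3 := congrArg (toCoord (φ p) (φ p)) h1
  rwa [toCoord_ofCoord_of_mem hy, toCoord_ofCoord_of_mem hy] at h3

/-- The energy-momentum tensor in the chart around `p`. -/
abbrev stressRep (g : Metric E M) (h : Metric F N) (φ : M → N) (δ₁ δ₂ : ℝ) (p : M) :
    E → E →L[ℝ] E →L[ℝ] ℝ :=
  stress (metricInChart g p) (metricInChart h (φ p)) (connection h (φ p)) (mapRep E F φ p (φ p))
    (fieldRep E (tension g h φ) p (φ p)) δ₁ δ₂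

theorem differentiableAt_stressRep (g : Metric E M) (h : Metric F N) {φ : M → N}
    (hφ : ContMDiff 𝓘(ℝ, E) 𝓘(ℝ, F) ∞ φ) (δ₁ δ₂ : ℝ) (p : M) (v w : E) :
    DifferentiableAt ℝ (fun x => stressRep g h φ δ₁ δ₂ p x v w) (chart E p p) := by
  have hp := mem_own_chart (E := E) p
  have hy := mem_own_chart (E := F) (φ p)
  exact (covDeriv_stress (isLeviCivitaAt_connection g hp) (isLeviCivitaAt_mapRep h φ hp hy)
    (contDiffAt_mapRep hφ hp hy) (contDiffAt_fieldRep_tension g h hφ hp hy) δ₁ δ₂ v v w).1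

theorem mdifferentiableAt_energyMomentum (g : Metric E M) (h : Metric F N) {φ : M → N}
    (hφ : ContMDiff 𝓘(ℝ, E) 𝓘(ℝ, F) ∞ φ) (δ₁ δ₂ : ℝ) (p : M) (v w : E) :
    MDifferentiableAt 𝓘(ℝ, E) 𝓘(ℝ, ℝ)
      (fun q => energyMomentum g h δ₁ δ₂ φ q (constField (ofCoord p p v : T E p) q)
        (constField (ofCoord p p w : T E p) q)) p := by
  rw [mdifferentiableAt_iff_chart (mem_own_chart (E := E) p)]
  exact (differentiableAt_stressRep g h hφ δ₁ δ₂ p v w).congr_of_eventuallyEq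
    (energyMomentum_constField g h hφ δ₁ δ₂ p v w)

/-- The covariant derivative of the energy-momentum tensor in coordinates. -/
theorem covTensor_energyMomentum (g : Metric E M) (h : Metric F N) {φ : M → N}
    (hφ : ContMDiff 𝓘(ℝ, E) 𝓘(ℝ, F) ∞ φ) (δ₁ δ₂ : ℝ) (p : M) (u v w : E) :
    covTensor g (energyMomentum g h δ₁ δ₂ φ) p (ofCoord p p u) (ofCoord p p v) (ofCoord p p w) =
      fderiv ℝ (fun x => stressRep g h φ δ₁ δ₂ p x v w) (chart E p p) u -
      stressRep g h φ δ₁ δ₂ p (chart E p p) (connection g p (chart E p p) u v) w -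
      stressRep g h φ δ₁ δ₂ p (chart E p p) v (connection g p (chart E p p) u w) := by
  have hp := mem_own_chart (E := E) p
  have hy := mem_own_chart (E := F) (φ p)
  have h1 := mvfderiv_ofCoord hp (mdifferentiableAt_energyMomentum g h hφ δ₁ δ₂ p v w) u
  have h2 := congrArg (fun L : E →L[ℝ] ℝ => L u)
    (energyMomentum_constField g h hφ δ₁ δ₂ p v w).fderiv_eq
  rw [covTensor, h1.trans h2, leviCivita_constField, leviCivita_constField,
    toCoord_ofCoord_of_mem hp, toCoord_ofCoord_of_mem hp, toCoord_ofCoord_of_mem hp,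
    energyMomentum_ofCoord g h hφ _ _ hp hy, energyMomentum_ofCoord g h hφ _ _ hp hy]

theorem divergence_energyMomentum (g : Metric E M) (h : Metric F N) {φ : M → N}
    (hφ : ContMDiff 𝓘(ℝ, E) 𝓘(ℝ, F) ∞ φ) (δ₁ δ₂ : ℝ)
    (hsemi : IsSemiBiharmonic g h δ₁ δ₂ φ) (p : M) (w : E) :
    divergence g (energyMomentum g h δ₁ δ₂ φ) p (ofCoord p p w) = 0 := by
  have hp := mem_own_chart (E := E) p
  have hy := mem_own_chart (E := F) (φ p)
  have hS := fun v => differentiableAt_stressRep g h hφ δ₁ δ₂ p v w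
  have hdiv := divergence_stress (isLeviCivitaAt_connection g hp) (isLeviCivitaAt_mapRep h φ hp hy)
    (contDiffAt_mapRep hφ hp hy) (contDiffAt_fieldRep_tension g h hφ hp hy) δ₁ δ₂
    (fieldRep_tension g h hφ hp hy).eq_of_nhds (hsemi.eq_in_chart hφ p) w
  have hcov := fun u v => covTensor_energyMomentum g h hφ δ₁ δ₂ p u v w
  change trace (metricInChart g p (chart E p p)) (fun u v =>
    fderiv ℝ (fun x => stressRep g h φ δ₁ δ₂ p x v w) (chart E p p) u -
      stressRep g h φ δ₁ δ₂ p (chart E p p) (connection g p (chart E p p) u v) w -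
      stressRep g h φ δ₁ δ₂ p (chart E p p) v (connection g p (chart E p p) u w)) = 0 at hdiv
  generalize stressRep g h φ δ₁ δ₂ p = S at hS hdiv hcov
  -- Moving the trace to coordinates requires bilinearity in `u, v`. Linearity of the derivative
  -- term in `v` rests on differentiability of the components of `S`.
  have hadd : ∀ v v', fderiv ℝ (fun z => S z (v + v') w) (chart E p p) =
      fderiv ℝ (fun z => S z v w) (chart E p p) + fderiv ℝ (fun z => S z v' w) (chart E p p) := by
    intro v v'
    simp only [map_add, add_apply]
    exact fderiv_fun_add (hS v) (hS v')
  have hsmul : ∀ (c : ℝ) v, fderiv ℝ (fun z => S z (c • v) w) (chart E p p) =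
      c • fderiv ℝ (fun z => S z v w) (chart E p p) := by
    intro c v
    simp only [map_smul, smul_apply]
    exact fderiv_fun_const_smul (hS v) c
  exact (traceAt_eq_trace g hp
    (fun u v => covTensor g (energyMomentum g h δ₁ δ₂ φ) p u v (ofCoord p p w))
    (LinearMap.mk₂ ℝ (fun u v => fderiv ℝ (fun z => S z v w) (chart E p p) u -
      S (chart E p p) (connection g p (chart E p p) u v) w -
      S (chart E p p) v (connection g p (chart E p p) u w))
      (by intros; simp only [map_add, add_apply]; ring)
      (by intros; simp only [map_smul, smul_apply, smul_eq_mul]; ring)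
      (by intros; rw [hadd]; simp only [map_add, add_apply]; ring)
      (by intros; rw [hsmul]; simp only [map_smul, smul_apply, smul_eq_mul]; ring))
    LinearMap.id hcov).trans hdiv

end EnergyMomentum

end SemiBiharmonic

end

theorem mainTheorem12
    {E : Type*} [NormedAddCommGroup E] [NormedSpace ℝ E] [FiniteDimensional ℝ E]
    {M : Type*} [TopologicalSpace M] [ChartedSpace E M] [IsManifold 𝓘(ℝ, E) ∞ M]
    {E' : Type*} [NormedAddCommGroup E'] [NormedSpace ℝ E'] [FiniteDimensional ℝ E']
    {N : Type*} [TopologicalSpace N] [ChartedSpace E' N] [IsManifold 𝓘(ℝ, E') ∞ N]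
    (g : SemiBiharmonic.Metric E M) (h : SemiBiharmonic.Metric E' N) (δ₁ δ₂ : ℝ)
    (φ : M → N) (hφ : ContMDiff 𝓘(ℝ, E) 𝓘(ℝ, E') ∞ φ)
    (hsemi : SemiBiharmonic.IsSemiBiharmonic g h δ₁ δ₂ φ) :
    SemiBiharmonic.IsDivergenceFree g (SemiBiharmonic.energyMomentum g h δ₁ δ₂ φ) := by
  refine ⟨fun p v w => ?_, fun p w => ?_⟩
  · rw [← SemiBiharmonic.ofCoord_toCoord p v, ← SemiBiharmonic.ofCoord_toCoord p w]
    exact SemiBiharmonic.mdifferentiableAt_energyMomentum g h hφ δ₁ δ₂ p _ _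
  · rw [← SemiBiharmonic.ofCoord_toCoord p w]
    exact SemiBiharmonic.divergence_energyMomentum g h hφ δ₁ δ₂ hsemi p _
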